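/- For a partial order $\varepsilon$, an inverse system over $\varepsilon$ is a contravariant functor from $\varepsilon$ to the category $\mathsf{Ab}$ of abelian groups, $\lim^n:\mathsf{Ab}^{\varepsilon^{\mathrm{op}}}\to\mathsf{Ab}$ is the $n$-th right derived functor of the inverse limit functor, and the cohomological dimension $\mathrm{cd}(\varepsilon)$ is the supremum in $\mathbb{N}\cup\{\infty\}$ of $\{n \mid \lim^n\neq 0\}$. For an ordinal $\varepsilon$, let $[A]^{m}$ denote the set of strictly increasing $m$-tuples of elements of $A\subseteq\varepsilon$. Let $\mathbf{P}_n(\varepsilon)$ and $\mathbf{R}_n(\varepsilon)$ be the inverse systems over $\varepsilon$ with terms $P_n([\alpha,\varepsilon))=\bigoplus_{[[\alpha,\varepsilon)]^{n+1}}\mathbb{Z}$ and $R_n([\alpha,\varepsilon))=\prod_{[[\alpha,\varepsilon)]^{n+1}}\mathbb{Z}$ ($\alpha<\varepsilon$) and the natural inclusions as bonding maps. For a tuple $\vec\alpha$ let $\vec\alpha^i$ be $\vec\alpha$ with its $i$-th coordinate omitted (counting from $0$), let $\langle\vec\alpha\rangle$ be the corresponding generator, and let $d_n:\langle\vec\alpha\rangle\mapsto\sum_{i=0}^{n}(-1)^i\langle\vec\alpha^i\rangle$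 be the boundary map $\mathbf{P}_n(\varepsilon)\to\mathbf{P}_{n-1}(\varepsilon)$ ($n\ge 1$). Write $=^*$ for equality of integer-valued functions at all but finitely many arguments. **Theorem.** Let $k\in\omega$. Then the cohomological dimension of $\omega_k$ is at least $k+1$. More precisely: 1. $\mathrm{cd}(\omega_k)\ge k+1$; 2. $\lim^{k+1}\mathbf{P}_{k+1}(\omega_k)\neq 0$; 3. $\lim^{k}\big(\mathbf{R}_{k+1}(\omega_k)/\mathbf{P}_{k+1}(\omega_k)\big)\neq 0$; 4. there are a set $\mathcal{B}\subseteq[\omega_k]^{k+2}$ and a family $f=(f(\vec\alpha))_{\vec\alpha\in[\omega_k]^{k+1}}$ with $f(\vec\alpha)\in R_{k+1}([\alpha_0,\omega_k))$ for all $\vec\alpha$, such that (a) $\{d_{k+1}\langle\vec b\rangle\mid\vec b\in\mathcal{B}\}$ is a basis of the inverse system $d_{k+1}\mathbf{P}_{k+1}(\omega_k)$, i.e. for every $\alpha<\omega_k$ each element of $d_{k+1}P_{k+1}([\alpha,\omega_k))$ is in exactly one way an integer combination of the elements $d_{k+1}\langle\vec b\rangle$ with $\vec b\in\mathcal{B}\cap[[\alpha,\omega_k)]^{k+2}$,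 and (b) $\sum_{i=0}^{k+1}(-1)^i f(\vec b^i)=\langle\vec b\rangle$ for all $\vec b\in\mathcal{B}$; 5. for all $\mathcal{B}$ and $f$ as in 4, $f$ represents a nonzero class modulo finite: one has $\sum_{i=0}^{k+1}(-1)^i f(\vec\alpha^i)=^*0$ for all $\vec\alpha\in[\omega_k]^{k+2}$, and there is no family $e=(e(\vec\beta))_{\vec\beta\in[\omega_k]^{k}}$ with $e(\vec\beta)\in R_{k+1}([\beta_0,\omega_k))$ for all $\vec\beta$ and $\sum_{i=0}^{k}(-1)^i e(\vec\alpha^i)=^*f(\vec\alpha)$ for all $\vec\alpha\in[\omega_k]^{k+1}$ (for $k=0$ the last clause means that $f(\vec\alpha)=^*0$ fails for some $\vec\alpha$). -/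

import Mathlib

open CategoryTheory CategoryTheory.Limits Opposite
open scoped Ordinal

noncomputable section

universe u

namespace InverseSystem

/-- Inverse systems of abelian groups indexed by a partial order `J`, i.e. contravariant functors
from `J` to abelian groups. -/
abbrev Sys (J : Type u) [PartialOrder J] : Type (u + 1) := Jᵒᵖ ⥤ AddCommGrpCat.{u}

/-- The category of inverse systems is a Grothendieck category, hence has enough injectives. -/
instance (J : Type u) [PartialOrder J] : IsGrothendieckAbelian.{u} (Jᵒᵖ ⥤ AddCommGrpCat.{u}) where
  ab5OfSize := { ofShape := fun _ _ _ => inferInstance }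

instance (J : Type u) [PartialOrder J] :
    (lim : (Jᵒᵖ ⥤ AddCommGrpCat.{u}) ⥤ AddCommGrpCat.{u}).Additive where
  map_add := by
    intro X Y f g
    apply limit.hom_ext
    intro j
    simp

/-- The `n`-th right derived functor of the inverse limit functor. -/
abbrev limDer (J : Type u) [PartialOrder J] (n : ℕ) : Sys J ⥤ AddCommGrpCat.{u} :=
  (lim : Sys J ⥤ AddCommGrpCat.{u}).rightDerived n

/-- The cohomological dimension of a partial order: the supremum in `ℕ∞` of all `n` for which
the functor `lim^n` is not zero. -/
def cohomologicalDim (J : Type u) [PartialOrder J] : ℕ∞ :=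
  sSup {m : ℕ∞ | ∃ n : ℕ, m = n ∧ ∃ X : Sys J, ¬ IsZero ((limDer J n).obj X)}

/-- The ordinal `ω_k` as a linear order. -/
abbrev OmegaType (k : ℕ) : Type := (ω_ (k : Ordinal.{0})).ToType

section Systems

variable {J : Type u} [LinearOrder J]

/-- Strictly increasing `(n+1)`-tuples of elements of `J`, i.e. `[J]^{n+1}`. -/
abbrev Tuple (J : Type u) [LinearOrder J] (n : ℕ) : Type u := Fin (n + 1) ↪o J

/-- The tuple with its `i`-th coordinate omitted. -/
def Tuple.face {n : ℕ} (t : Tuple J (n + 1)) (i : Fin (n + 2)) : Tuple J n :=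
  (Fin.succAboveOrderEmb i).trans t

/-- The free abelian group on the `(n+1)`-tuples with all coordinates in `[a, ∞)`, as a
subgroup of the free abelian group on all `(n+1)`-tuples. -/
def PGroup (J : Type u) [LinearOrder J] (n : ℕ) (a : J) : AddSubgroup (Tuple J n →₀ ℤ) where
  carrier := {x | ∀ t, x t ≠ 0 → ∀ i, a ≤ t i}
  zero_mem' := fun t h => absurd rfl h
  add_mem' := by
    intro x y hx hy t h
    by_cases hxt : x t = 0
    · exact hy t fun hyt => h (by simp [hxt, hyt])
    · exact hx t hxt
  neg_mem' := by
    intro x hx t h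
    exact hx t fun hxt => h (by simp [hxt])

/-- The product of copies of `ℤ` over the `(n+1)`-tuples with all coordinates in `[a, ∞)`, as a
subgroup of the product over all `(n+1)`-tuples. -/
def RGroup (J : Type u) [LinearOrder J] (n : ℕ) (a : J) : AddSubgroup (Tuple J n → ℤ) where
  carrier := {x | ∀ t, x t ≠ 0 → ∀ i, a ≤ t i}
  zero_mem' := fun t h => absurd rfl h
  add_mem' := by
    intro x y hx hy t h
    by_cases hxt : x t = 0
    · exact hy t fun hyt => h (by simp [hxt, hyt])
    · exact hx t hxt
  neg_mem' := by
    intro x hx t h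
    exact hx t fun hxt => h (by simp [hxt])

theorem PGroup_le (n : ℕ) {a b : J} (h : a ≤ b) : PGroup J n b ≤ PGroup J n a :=
  fun _ hx t ht i => h.trans (hx t ht i)

theorem RGroup_le (n : ℕ) {a b : J} (h : a ≤ b) : RGroup J n b ≤ RGroup J n a :=
  fun _ hx t ht i => h.trans (hx t ht i)

/-- The inverse system `P_n`, with the inclusions as bonding maps. -/
def PSys (J : Type u) [LinearOrder J] (n : ℕ) : Sys J where
  obj a := AddCommGrpCat.of (PGroup J n a.unop)
  map f := AddCommGrpCat.ofHom (AddSubgroup.inclusion (PGroup_le n (leOfHom f.unop)))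

/-- The inverse system `R_n`, with the inclusions as bonding maps. -/
def RSys (J : Type u) [LinearOrder J] (n : ℕ) : Sys J where
  obj a := AddCommGrpCat.of (RGroup J n a.unop)
  map f := AddCommGrpCat.ofHom (AddSubgroup.inclusion (RGroup_le n (leOfHom f.unop)))

/-- The inclusion of the direct sums in the products. -/
def PToR (J : Type u) [LinearOrder J] (n : ℕ) : PSys J n ⟶ RSys J n where
  app a := AddCommGrpCat.ofHom
    { toFun := fun x => (⟨fun t => x.1 t, x.2⟩ : RGroup J n a.unop)
      map_zero' := rfl
      map_add' := fun _ _ => rfl }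

/-- The quotient system `R_n / P_n`. -/
def RModP (J : Type u) [LinearOrder J] (n : ℕ) : Sys J := cokernel (PToR J n)

/-- The simplicial boundary map `d_{n+1}`, from the free abelian group on `(n+2)`-tuples to the
free abelian group on `(n+1)`-tuples. -/
def boundary (J : Type u) [LinearOrder J] (n : ℕ) :
    (Tuple J (n + 1) →₀ ℤ) →+ (Tuple J n →₀ ℤ) :=
  Finsupp.liftAddHom fun t =>
    ∑ i : Fin (n + 2), (-1 : ℤ) ^ (i : ℕ) • Finsupp.singleAddHom (t.face i)

/-- The set `d_{n+1} B = {d_{n+1}⟨b⟩ | b ∈ B}` is a basis of the inverse system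
`d_{n+1} P_{n+1}`: for every `a`, each element of `d_{n+1} P_{n+1}([a, ∞))` is in a unique way
a combination of elements `d_{n+1}⟨b⟩` with `b ∈ B` contained in `[a, ∞)`. -/
def IsBoundaryBasis (n : ℕ) (B : Set (Tuple J (n + 1))) : Prop :=
  ∀ a : J, ∀ x ∈ PGroup J (n + 1) a,
    ∃! z : Tuple J (n + 1) →₀ ℤ,
      z ∈ PGroup J (n + 1) a ∧ (z.support : Set (Tuple J (n + 1))) ⊆ B ∧
        boundary J n z = boundary J n x

/-- The cochain group `K^j(R_m)`, the product over all `(j+1)`-tuples `t` of the terms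
of `R_m` at the least coordinate of `t`. -/
def IsCochain {j m : ℕ} (c : Tuple J j → Tuple J m → ℤ) : Prop :=
  ∀ t, c t ∈ RGroup J m (t 0)

/-- The alternating sum `∑ i, (-1)^i c(t^i)` defining the coboundary. -/
def coboundary {j m : ℕ} (c : Tuple J j → Tuple J m → ℤ) (t : Tuple J (j + 1)) :
    Tuple J m → ℤ :=
  ∑ i : Fin (j + 2), (-1 : ℤ) ^ (i : ℕ) • c (t.face i)

/-- Equality of integer-valued functions modulo finite. -/
def EqModFinite {T : Type u} (x y : T → ℤ) : Prop := {t | x t ≠ y t}.Finite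

/-- The class of `c` modulo finite is a cocycle of `K(R_m / P_m)`. -/
def IsCoherent {j m : ℕ} (c : Tuple J j → Tuple J m → ℤ) : Prop :=
  ∀ t, EqModFinite (coboundary c t) 0

/-- The class of `c` modulo finite is a coboundary of `K(R_m / P_m)`. In degree `0` this
means that the class is zero. -/
def IsTrivial {m : ℕ} : {j : ℕ} → (Tuple J j → Tuple J m → ℤ) → Prop
  | 0, c => ∀ t, EqModFinite 0 (c t)
  | j + 1, c => ∃ e : Tuple J j → Tuple J m → ℤ,
      IsCochain e ∧ ∀ t, EqModFinite (coboundary e t) (c t)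

open Classical in
/-- The homomorphism from `P_n` to `R_{n+1}` given by the cochain `f` extends the section of
`d_{n+1}` which belongs to the basis `d_{n+1} B`, i.e. which sends `d_{n+1}⟨b⟩` to `⟨b⟩` for
each `b ∈ B`. -/
def ExtendsSection {n : ℕ} (B : Set (Tuple J (n + 1)))
    (f : Tuple J n → Tuple J (n + 1) → ℤ) : Prop :=
  ∀ b ∈ B, coboundary f b = Pi.single b 1

end Systems

end InverseSystem

end

/-! Simplices are finite subsets of J. The n-element chains on [a, ∞) form systems C_n with cycle
subsystems Z_n; Z_0 is the constant system ℤ. Coning makes every sequence 0 → Z_(n+1) → C_(n+1) →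
Z_n → 0 exact, and each C_(n+1) is projective, being a sum of systems freely generated at the least
vertex of a simplex. Hence lim^(n+1) X is the obstruction to extending morphisms Z_(n+1) → X to
C_(n+1). Only the needed half is proved, by dimension shifting along an injective resolution
(`exists_extension_of_isZero`).

Two facts of opposite nature about ω_k give the theorem. Since its size is below ℵ_(k+1), the
boundaries of (k+2)-element chains have a basis compatible with all tails (`exists_isChainBasis`),
so the boundary map onto them has a section into P_(k+1). Since its cofinality is ℵ_k, the boundary
map on (k+1)-element chains does not split compatibly with tails (`not_isSplitting`). Both are
proved by induction on the cardinal, one dimension at a time.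

The section does not extend from boundaries to a morphism P_k → P_(k+1): an extension r would make
id - d r a splitting (`not_exists_retraction`). This is the nonvanishing of lim^(k+1) P_(k+1). With
values in R_(k+1) the extension does exist (`exists_extendsSection`), and this is f. On boundaries f
is finitely supported, hence coherent. If f were trivial modulo finite, subtracting the
trivialization would give a forbidden r (`not_eqModFinite_of_coboundary_eq_zero`). Vanishing of
lim^k (R/P) would produce such a trivialization. -/

set_option linter.unusedSectionVars false

noncomputable section

namespace InverseSystem

/-! ### Augmented simplicial chains, cones and links -/

section Chains

variable {J : Type*} [LinearOrder J]

/-- The augmented ordered chains of `J`: the free abelian group on the finite subsets of `J`. -/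
abbrev Chain (J : Type*) : Type _ := Finset J →₀ ℤ

/-- The sign of the position of `p` relative to `s`. -/
def positionSign (p : J) (s : Finset J) : ℤ := (-1) ^ (s.filter (· < p)).card

theorem positionSign_mul_self (p : J) (s : Finset J) :
    positionSign p s * positionSign p s = 1 := by
  rw [positionSign, ← pow_add, ← two_mul, pow_mul]; simp

theorem positionSign_insert_self (p : J) (s : Finset J) :
    positionSign p (insert p s) = positionSign p s := by
  simp [positionSign, Finset.filter_insert]

theorem positionSign_erase_self (p : J) (s : Finset J) :
    positionSign p (s.erase p) = positionSign p s := by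
  simp [positionSign, Finset.filter_erase]

theorem positionSign_insert_of_lt {p q : J} (h : p < q) {s : Finset J} (hp : p ∉ s) :
    positionSign q (insert p s) = -positionSign q s := by
  simp [positionSign, Finset.filter_insert, h, hp, pow_succ]

theorem positionSign_insert_of_gt {p q : J} (h : q < p) (s : Finset J) :
    positionSign q (insert p s) = positionSign q s := by
  simp [positionSign, Finset.filter_insert, h.not_gt]

/-- The cone with apex `p`: the signed insertion of `p`. -/
def cone (p : J) : Chain J →ₗ[ℤ] Chain J :=
  Finsupp.linearCombination ℤ fun s =>
    if p ∈ s then 0 else Finsupp.single (insert p s) (positionSign p s)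

/-- The signed removal of `p`. -/
def link (p : J) : Chain J →ₗ[ℤ] Chain J :=
  Finsupp.linearCombination ℤ fun s =>
    if p ∈ s then Finsupp.single (s.erase p) (positionSign p s) else 0

/-- The augmented simplicial boundary. -/
def bd : Chain J →ₗ[ℤ] Chain J :=
  Finsupp.linearCombination ℤ fun s => ∑ x ∈ s, link x (Finsupp.single s 1)

theorem cone_single_of_mem {p : J} {s : Finset J} (h : p ∈ s) (c : ℤ) :
    cone p (Finsupp.single s c) = 0 := by
  simp [cone, h]

theorem cone_single_of_notMem {p : J} {s : Finset J} (h : p ∉ s) (c : ℤ) :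
    cone p (Finsupp.single s c) = Finsupp.single (insert p s) (c * positionSign p s) := by
  simp [cone, h]

theorem link_single_of_mem {p : J} {s : Finset J} (h : p ∈ s) (c : ℤ) :
    link p (Finsupp.single s c) = Finsupp.single (s.erase p) (c * positionSign p s) := by
  simp [link, h]

theorem link_single_of_notMem {p : J} {s : Finset J} (h : p ∉ s) (c : ℤ) :
    link p (Finsupp.single s c) = 0 := by
  simp [link, h]

theorem bd_single (s : Finset J) :
    bd (Finsupp.single s 1) = ∑ x ∈ s, link x (Finsupp.single s 1) := by
  simp [bd]

theorem Chain.lhom_ext {M : Type*} [AddCommGroup M] {f g : Chain J →ₗ[ℤ] M}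
    (h : ∀ s, f (Finsupp.single s 1) = g (Finsupp.single s 1)) : f = g :=
  Finsupp.lhom_ext' fun s => LinearMap.ext_ring (h s)

theorem link_cone_of_ne {p q : J} (h : p ≠ q) (x : Chain J) :
    link q (cone p x) = -cone p (link q x) := by
  suffices link q ∘ₗ cone p = -(cone p ∘ₗ link q) from LinearMap.congr_fun this x
  refine Chain.lhom_ext fun s => ?_
  simp only [LinearMap.comp_apply, LinearMap.neg_apply]
  by_cases hp : p ∈ s
  · rw [cone_single_of_mem hp, map_zero]
    by_cases hq : q ∈ s
    · rw [link_single_of_mem hq, cone_single_of_mem (Finset.mem_erase.2 ⟨h, hp⟩), neg_zero]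
    · rw [link_single_of_notMem hq, map_zero, neg_zero]
  · rw [cone_single_of_notMem hp]
    by_cases hq : q ∈ s
    · rw [link_single_of_mem hq, link_single_of_mem (Finset.mem_insert_of_mem hq),
        cone_single_of_notMem fun h' => hp (Finset.mem_of_mem_erase h'),
        Finset.erase_insert_of_ne h, ← Finsupp.single_neg]
      congr 1
      obtain ⟨t, hqt, rfl⟩ : ∃ t, q ∉ t ∧ insert q t = s :=
        ⟨s.erase q, Finset.notMem_erase _ _, Finset.insert_erase hq⟩
      rw [Finset.erase_insert hqt, Finset.insert_comm, positionSign_insert_self,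
        positionSign_insert_self]
      rcases lt_or_gt_of_ne h with h' | h'
      · rw [positionSign_insert_of_lt h' fun h' => hp (Finset.mem_insert_of_mem h'),
          positionSign_insert_of_gt h']
        ring
      · rw [positionSign_insert_of_lt h' hqt, positionSign_insert_of_gt h']
        ring
    · rw [link_single_of_notMem hq, link_single_of_notMem (by simp [h.symm, hq]), map_zero,
        neg_zero]

/-- On each simplex exactly one of the two terms survives. The first is the part of a chain avoiding
p, the second the part through p; all later arguments about a top vertex use this decomposition. -/
theorem link_cone_self (p : J) (x : Chain J) : link p (cone p x) + cone p (link p x) = x := by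
  suffices link p ∘ₗ cone p + cone p ∘ₗ link p = LinearMap.id from LinearMap.congr_fun this x
  refine Chain.lhom_ext fun s => ?_
  simp only [LinearMap.comp_apply, LinearMap.add_apply, LinearMap.id_apply]
  by_cases hp : p ∈ s
  · rw [cone_single_of_mem hp, link_single_of_mem hp,
      cone_single_of_notMem (Finset.notMem_erase _ _), Finset.insert_erase hp,
      positionSign_erase_self, one_mul, positionSign_mul_self, map_zero, zero_add]
  · rw [link_single_of_notMem hp, cone_single_of_notMem hp,
      link_single_of_mem (Finset.mem_insert_self _ _), Finset.erase_insert hp,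
      positionSign_insert_self, one_mul, positionSign_mul_self, map_zero, add_zero]

/-- The cone is a contracting homotopy. Since the boundary is a sum of links, the formula reduces to
the two link-cone identities: links at other vertices cancel, and the link at p contributes the
identity. -/
theorem bd_cone (p : J) (x : Chain J) : bd (cone p x) = x - cone p (bd x) := by
  rw [eq_sub_iff_add_eq]
  suffices bd ∘ₗ cone p + cone p ∘ₗ bd = LinearMap.id from LinearMap.congr_fun this x
  refine Chain.lhom_ext fun s => ?_
  simp only [LinearMap.comp_apply, LinearMap.add_apply, LinearMap.id_apply]
  by_cases hp : p ∈ s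
  · rw [cone_single_of_mem hp, map_zero, zero_add, bd_single, map_sum,
      Finset.sum_eq_single_of_mem p hp]
    · have := link_cone_self p (Finsupp.single s 1)
      rwa [cone_single_of_mem hp, map_zero, zero_add] at this
    · intro q _ hq
      have := link_cone_of_ne hq.symm (Finsupp.single s 1)
      rwa [cone_single_of_mem hp, map_zero, eq_comm, neg_eq_zero] at this
  · have key : bd (cone p (Finsupp.single s 1)) =
        ∑ x ∈ insert p s, link x (cone p (Finsupp.single s 1)) := by
      have : Finsupp.single (insert p s) (1 * positionSign p s) =
          positionSign p s • Finsupp.single (insert p s) (1 : ℤ) := by simp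
      rw [cone_single_of_notMem hp, this, map_smul, bd_single, Finset.smul_sum]
      simp only [map_smul]
    have h0 : link p (Finsupp.single s (1 : ℤ)) = 0 := link_single_of_notMem hp 1
    have h1 := link_cone_self p (Finsupp.single s 1)
    rw [h0, map_zero, add_zero] at h1
    rw [key, Finset.sum_insert hp, h1, bd_single, map_sum, add_assoc, ← Finset.sum_add_distrib,
      Finset.sum_eq_zero, add_zero]
    intro q hq
    rw [link_cone_of_ne (fun h : p = q => hp (h ▸ hq)), neg_add_cancel]

theorem bd_bd (x : Chain J) : bd (bd x) = 0 := by
  suffices (bd ∘ₗ bd : Chain J →ₗ[ℤ] Chain J) = 0 from LinearMap.congr_fun this x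
  refine Chain.lhom_ext fun s => ?_
  simp only [LinearMap.comp_apply, LinearMap.zero_apply]
  induction s using Finset.induction_on with
  | empty => simp [bd_single]
  | insert p s hp ih =>
    have h : Finsupp.single (insert p s) (1 : ℤ) =
        positionSign p s • cone p (Finsupp.single s 1) := by
      rw [cone_single_of_notMem hp, Finsupp.smul_single, one_mul, smul_eq_mul,
        positionSign_mul_self]
    rw [h, map_smul, map_smul, bd_cone, map_sub, bd_cone, ih]
    simp

/-- The chains on the `n`-element subsets of `S`. -/
def chains (n : ℕ) (S : Set J) : Submodule ℤ (Chain J) :=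
  Finsupp.supported ℤ ℤ {s | s.card = n ∧ (s : Set J) ⊆ S}

theorem mem_chains {n : ℕ} {S : Set J} {x : Chain J} :
    x ∈ chains n S ↔ ∀ s, x s ≠ 0 → s.card = n ∧ (s : Set J) ⊆ S := by
  rw [chains, Finsupp.mem_supported]
  simp [Set.subset_def]

theorem single_mem_chains {n : ℕ} {S : Set J} {s : Finset J} (h : s.card = n)
    (hs : (s : Set J) ⊆ S) (c : ℤ) : Finsupp.single s c ∈ chains n S :=
  Finsupp.single_mem_supported ℤ c (show _ ∈ {s : Finset J | _} from ⟨h, hs⟩)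

theorem chains_mono {n : ℕ} {S T : Set J} (h : S ⊆ T) : chains n S ≤ chains n T :=
  Finsupp.supported_mono fun _ hs => ⟨hs.1, hs.2.trans h⟩

theorem supported_induction {T : Type*} {S : Set T} {N : Submodule ℤ (T →₀ ℤ)}
    (h : ∀ s ∈ S, Finsupp.single s 1 ∈ N) : Finsupp.supported ℤ ℤ S ≤ N := by
  rw [Finsupp.supported_eq_span_single, Submodule.span_le]
  rintro _ ⟨s, hs, rfl⟩
  exact h s hs

theorem map_mem_of_single {T M : Type*} [AddCommGroup M] {S : Set T}
    {f : (T →₀ ℤ) →ₗ[ℤ] M} {N : Submodule ℤ M} (h : ∀ s ∈ S, f (Finsupp.single s 1) ∈ N)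
    {x : T →₀ ℤ} (hx : x ∈ Finsupp.supported ℤ ℤ S) : f x ∈ N :=
  supported_induction (N := N.comap f) h hx

theorem cone_mem {n : ℕ} {S : Set J} {p : J} (hp : p ∈ S) {x : Chain J} (hx : x ∈ chains n S) :
    cone p x ∈ chains (n + 1) S := by
  refine map_mem_of_single (fun s hs => ?_) hx
  by_cases h : p ∈ s
  · rw [cone_single_of_mem h]
    exact zero_mem _
  · rw [cone_single_of_notMem h]
    refine single_mem_chains (by rw [Finset.card_insert_of_notMem h, hs.1]) ?_ _
    rw [Finset.coe_insert]
    exact Set.insert_subset hp hs.2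

theorem link_mem {n : ℕ} {S : Set J} {p : J} {x : Chain J} (hx : x ∈ chains (n + 1) S) :
    link p x ∈ chains n S := by
  refine map_mem_of_single (fun s hs => ?_) hx
  by_cases h : p ∈ s
  · rw [link_single_of_mem h]
    refine single_mem_chains (by rw [Finset.card_erase_of_mem h, hs.1]; rfl) ?_ _
    exact fun y hy => hs.2 (Finset.mem_of_mem_erase (Finset.mem_coe.1 hy))
  · rw [link_single_of_notMem h]
    exact zero_mem _

theorem bd_mem {n : ℕ} {S : Set J} {x : Chain J} (hx : x ∈ chains (n + 1) S) :
    bd x ∈ chains n S := by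
  refine map_mem_of_single (fun s hs => ?_) hx
  rw [bd_single]
  exact sum_mem fun p _ => link_mem (single_mem_chains hs.1 hs.2 1)

theorem eq_zero_of_chains_empty {n : ℕ} {x : Chain J} (hx : x ∈ chains (n + 1) (∅ : Set J)) :
    x = 0 := by
  ext s
  by_contra h
  obtain ⟨h1, h2⟩ := mem_chains.1 hx s h
  have : s = ∅ := by simpa [Set.subset_empty_iff] using h2
  simp [this] at h1

/-- A cone whose apex is any point of S stays inside S, so exactness holds in every set, in
particular in every tail. The empty S is harmless because simplices here have at least one vertex.
-/
theorem exists_bd_eq {n : ℕ} {S : Set J} {x : Chain J} (hx : x ∈ chains (n + 1) S)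
    (h : bd x = 0) : ∃ y ∈ chains (n + 2) S, bd y = x := by
  rcases S.eq_empty_or_nonempty with rfl | ⟨p, hp⟩
  · exact ⟨0, zero_mem _, by rw [eq_zero_of_chains_empty hx, map_zero]⟩
  · exact ⟨cone p x, cone_mem hp hx, by rw [bd_cone, h, map_zero, sub_zero]⟩

/-- The vertices of the simplices of a chain. -/
def verts (x : Chain J) : Finset J := x.support.biUnion id

theorem mem_verts {x : Chain J} {p : J} : p ∈ verts x ↔ ∃ s, x s ≠ 0 ∧ p ∈ s := by
  simp [verts]

theorem verts_subset {n : ℕ} {S : Set J} {x : Chain J} (hx : x ∈ chains n S) :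
    (verts x : Set J) ⊆ S := fun p hp => by
  obtain ⟨s, hs, hps⟩ := mem_verts.1 (Finset.mem_coe.1 hp)
  exact (mem_chains.1 hx s hs).2 hps

theorem mem_chains_of_verts {n : ℕ} {S T : Set J} {x : Chain J} (hx : x ∈ chains n S)
    (h : (verts x : Set J) ⊆ T) : x ∈ chains n T :=
  mem_chains.2 fun s hs => ⟨(mem_chains.1 hx s hs).1, fun _ hp => h (mem_verts.2 ⟨s, hs, hp⟩)⟩

open Classical in
/-- The projection to the chains on subsets of `S`. -/
def restr (S : Set J) : Chain J →ₗ[ℤ] Chain J :=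
  Finsupp.linearCombination ℤ fun s => if (s : Set J) ⊆ S then Finsupp.single s 1 else 0

theorem restr_mem {n : ℕ} {S T : Set J} {x : Chain J} (hx : x ∈ chains n T) :
    restr S x ∈ chains n (S ∩ T) := by
  refine map_mem_of_single (fun s hs => ?_) hx
  by_cases h : (s : Set J) ⊆ S
  · simpa [restr, h] using single_mem_chains hs.1 (Set.subset_inter h hs.2) 1
  · simp [restr, h]

theorem restr_eq_self {n : ℕ} {S : Set J} {x : Chain J} (hx : x ∈ chains n S) :
    restr S x = x := by
  have : restr S x - x ∈ (⊥ : Submodule ℤ (Chain J)) :=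
    map_mem_of_single (f := restr S - LinearMap.id) (fun s hs => by simp [restr, hs.2]) hx
  rwa [Submodule.mem_bot, sub_eq_zero] at this

end Chains

/-! ### Bases of boundaries for sets of small cardinality -/

section Basis

universe u

open Cardinal

variable {J : Type u} [LinearOrder J]

/-- `B` consists of `(n+1)`-element subsets of `A`, whose boundaries are a basis of the
boundaries of `A ∩ [a, ∞)`, for all `a`. -/
structure IsChainBasis (n : ℕ) (A : Set J) (B : Set (Finset J)) : Prop where
  subset : B ⊆ {s | s.card = n + 1 ∧ (s : Set J) ⊆ A}
  span : ∀ a, ∀ x ∈ chains (n + 1) (A ∩ Set.Ici a),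
    ∃ z ∈ chains (n + 1) (A ∩ Set.Ici a), z ∈ Finsupp.supported ℤ ℤ B ∧ bd z = bd x
  inj : ∀ z ∈ Finsupp.supported ℤ ℤ B, bd z = 0 → z = 0

/-- The ranks come from a bijection with the initial ordinal of #A, whose proper initial segments
are smaller. This well-order is unrelated to the order of J and only drives the induction on
cardinality. -/
theorem exists_rank (A : Set J) : ∃ e : J → Ordinal.{u}, Set.InjOn e A ∧
    ∀ p ∈ A, #{q // q ∈ A ∧ e q < e p} < #A := by
  classical
  obtain ⟨g⟩ : Nonempty (A ≃ (#A).ord.ToType) := by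
    rw [← Cardinal.eq, Cardinal.mk_toType, Cardinal.card_ord]
  refine ⟨fun p => if h : p ∈ A then ((g ⟨p, h⟩).toOrd : Ordinal) else 0, ?_, ?_⟩
  · intro p hp q hq h
    beta_reduce at h
    rw [dif_pos (show p ∈ A from hp), dif_pos (show q ∈ A from hq)] at h
    exact congrArg Subtype.val (g.injective ((OrderIso.injective _) (Subtype.ext h)))
  · intro p hp
    refine lt_of_le_of_lt ?_ (?_ : #(Set.Iio (g ⟨p, hp⟩)) < #A)
    refine Cardinal.mk_le_of_injective (f := fun q : {q // q ∈ A ∧ _} => ⟨g ⟨q.1, q.2.1⟩, ?_⟩) ?_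
    · have h := q.2.2
      simp only [hp, q.2.1, dif_pos] at h
      exact (OrderIso.lt_iff_lt _).1 (Subtype.coe_lt_coe.1 h)
    · intro q q' h
      have := g.injective (congrArg Subtype.val h)
      exact Subtype.ext (Subtype.mk.inj this)
    · have h := Cardinal.mk_Iio_lt (g ⟨p, hp⟩)
      rw [Cardinal.mk_toType, Cardinal.card_ord, Ordinal.type_toType] at h
      exact h rfl

theorem isChainBasis_empty (n : ℕ) : IsChainBasis n (∅ : Set J) ∅ where
  subset := Set.empty_subset _
  span a x hx := by
    rw [Set.empty_inter] at hx
    rw [eq_zero_of_chains_empty hx]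
    exact ⟨0, zero_mem _, zero_mem _, rfl⟩
  inj z hz _ := by
    rwa [Finsupp.supported_empty, Submodule.mem_bot] at hz

theorem bd_singleton (p : J) (c : ℤ) :
    bd (Finsupp.single {p} c) = Finsupp.single ∅ c := by
  rw [← mul_one c, ← smul_eq_mul, ← Finsupp.smul_single, map_smul, bd_single,
    Finset.sum_singleton, link_single_of_mem (Finset.mem_singleton_self p), Finset.erase_singleton]
  simp [positionSign, Finset.filter_singleton]

theorem eq_single_empty {S : Set J} {x : Chain J} (hx : x ∈ chains 0 S) :
    x = Finsupp.single ∅ (x ∅) := by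
  ext s
  by_cases h : x s = 0
  · rw [h, Finsupp.single_apply]
    split_ifs with h'
    · rw [h', h]
    · rfl
  · rw [Finset.card_eq_zero.1 (mem_chains.1 hx s h).1, Finsupp.single_eq_same]

/-- The maximum of A lies in every tail that meets A, so the single vertex at it generates the
augmentation in all tails at once. -/
theorem exists_isChainBasis_of_finite {A : Set J} (hA : A.Finite) :
    ∃ B, IsChainBasis 0 A B := by
  rcases A.eq_empty_or_nonempty with rfl | hne
  · exact ⟨∅, isChainBasis_empty 0⟩
  obtain ⟨m, hm, hmax⟩ := hA.exists_maximal hne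
  have hmax' : ∀ q ∈ A, q ≤ m := fun q hq => (le_total q m).elim id fun h => hmax hq h
  refine ⟨{{m}}, ⟨?_, ?_, ?_⟩⟩
  · rintro _ rfl
    simpa using hm
  · intro a x hx
    by_cases ha : a ≤ m
    · refine ⟨Finsupp.single {m} (bd x ∅), ?_, ?_, ?_⟩
      · exact single_mem_chains rfl (by simpa using ⟨hm, ha⟩) _
      · exact Finsupp.single_mem_supported ℤ _ rfl
      · rw [bd_singleton, ← eq_single_empty (bd_mem hx)]
    · have : A ∩ Set.Ici a = ∅ := by
        ext q
        simp only [Set.mem_inter_iff, Set.mem_Ici, Set.mem_empty_iff_false, iff_false, not_and]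
        exact fun hq h => ha (h.trans (hmax' q hq))
      rw [this] at hx
      exact ⟨0, zero_mem _, zero_mem _, by rw [eq_zero_of_chains_empty hx]⟩
  · intro z hz h
    obtain ⟨c, rfl⟩ : ∃ c, z = Finsupp.single {m} c :=
      Finsupp.support_subset_singleton'.1 fun s hs => Finset.mem_singleton.2 (hz hs)
    rw [bd_singleton, Finsupp.single_eq_zero] at h
    rw [h, Finsupp.single_zero]

theorem link_eq_zero {n : ℕ} {S : Set J} {p : J} (hp : p ∉ S) {x : Chain J}
    (hx : x ∈ chains n S) : link p x = 0 := by
  rw [← Submodule.mem_bot ℤ]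
  refine map_mem_of_single (fun s hs => ?_) hx
  rw [link_single_of_notMem fun h => hp (hs.2 h)]
  exact zero_mem _

theorem link_mem_diff {n : ℕ} {S : Set J} {p : J} {x : Chain J} (hx : x ∈ chains (n + 1) S) :
    link p x ∈ chains n (S \ {p}) := by
  refine map_mem_of_single (fun s hs => ?_) hx
  by_cases h : p ∈ s
  · rw [link_single_of_mem h]
    refine single_mem_chains (by rw [Finset.card_erase_of_mem h, hs.1]; rfl) ?_ _
    intro q hq
    rw [Finset.coe_erase] at hq
    exact ⟨hs.2 hq.1, hq.2⟩
  · rw [link_single_of_notMem h]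
    exact zero_mem _

theorem link_cone_mem_diff {n : ℕ} {S : Set J} {p : J} {x : Chain J} (hx : x ∈ chains n S) :
    link p (cone p x) ∈ chains n (S \ {p}) := by
  refine map_mem_of_single (f := link p ∘ₗ cone p) (fun s hs => ?_) hx
  rw [LinearMap.comp_apply]
  by_cases h : p ∈ s
  · rw [cone_single_of_mem h, map_zero]
    exact zero_mem _
  · rw [cone_single_of_notMem h, link_single_of_mem (Finset.mem_insert_self _ _),
      Finset.erase_insert h]
    exact single_mem_chains hs.1 (Set.subset_sdiff_singleton hs.2 h) _

theorem link_bd_cone_of_notMem {n : ℕ} {S : Set J} {p : J} (hp : p ∉ S) {w : Chain J}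
    (hw : w ∈ chains (n + 1) S) : link p (bd (cone p w)) = -bd w := by
  have h := link_cone_self p (bd w)
  rw [link_eq_zero hp (bd_mem hw), map_zero, add_zero] at h
  rw [bd_cone, map_sub, link_eq_zero hp hw, h, zero_sub]

/-- The elements of `A` of rank less than `ξ`. -/
def below (A : Set J) (e : J → Ordinal.{u}) (ξ : Ordinal.{u}) : Set J := {q | q ∈ A ∧ e q < ξ}

/-- A basis simplex has a vertex p of highest rank, and its opposite face is taken from a basis, one
dimension lower, of the smaller set below p. Peeling off the vertex of highest rank proves
generation as well as independence. -/
theorem exists_isChainBasis_succ {n : ℕ} {A : Set J} {e : J → Ordinal.{u}} (he : Set.InjOn e A)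
    {B : J → Set (Finset J)} (hB : ∀ p ∈ A, IsChainBasis n (below A e (e p)) (B p)) :
    IsChainBasis (n + 1) A {s | ∃ p ∈ A, ∃ t ∈ B p, insert p t = s} where
  subset := by
    rintro _ ⟨p, hp, t, ht, rfl⟩
    obtain ⟨h1, h2⟩ := (hB p hp).subset ht
    have hpt : p ∉ t := fun h => lt_irrefl _ (h2 h).2
    refine ⟨by rw [Finset.card_insert_of_notMem hpt, h1], ?_⟩
    rw [Finset.coe_insert]
    exact Set.insert_subset hp fun q hq => (h2 hq).1
  span := by
    intro a
    -- A bound on the ranks of the vertices is carried along for transfinite induction.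
    suffices ∀ ξ : Ordinal.{u}, ∀ x ∈ chains (n + 1 + 1) (A ∩ Set.Ici a),
        (∀ q ∈ verts x, e q < ξ) → ∃ z ∈ chains (n + 1 + 1) (A ∩ Set.Ici a),
          z ∈ Finsupp.supported ℤ ℤ {s | ∃ p ∈ A, ∃ t ∈ B p, insert p t = s} ∧ bd z = bd x by
      intro x hx
      refine this (((verts x).sup e) + 1) x hx fun q hq => ?_
      rw [← Order.succ_eq_add_one, Order.lt_succ_iff]
      exact Finset.le_sup hq
    intro ξ
    induction ξ using WellFoundedLT.induction with
    | _ ξ ih =>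
    intro x hx hξ
    rcases (verts x).eq_empty_or_nonempty with h0 | hne
    · refine ⟨0, zero_mem _, zero_mem _, ?_⟩
      have : x ∈ chains (n + 1 + 1) (∅ : Set J) := mem_chains_of_verts hx (by simp [h0])
      rw [eq_zero_of_chains_empty this]
    obtain ⟨p, hpx, hmax⟩ := (verts x).exists_max_image e hne
    have hpm : p ∈ A ∩ Set.Ici a := verts_subset hx hpx
    obtain ⟨hpA, hpa⟩ := hpm
    have hlt : ∀ q ∈ A, q ∈ verts x → q ≠ p → e q < e p := fun q hq hqx hqp =>
      lt_of_le_of_ne (hmax q hqx) fun h => hqp (he hq hpA h)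
    have hS : ((A ∩ Set.Ici a) ∩ (verts x : Set J)) \ {p} ⊆ below A e (e p) ∩ Set.Ici a :=
      fun q hq => ⟨⟨hq.1.1.1, hlt q hq.1.1.1 hq.1.2 hq.2⟩, hq.1.1.2⟩
    have hbelow : below A e (e p) ∩ Set.Ici a ⊆ A ∩ Set.Ici a := fun q hq => ⟨hq.1.1, hq.2⟩
    have hx' : x ∈ chains (n + 1 + 1) ((A ∩ Set.Ici a) ∩ verts x) :=
      mem_chains_of_verts hx (Set.subset_inter (verts_subset hx) le_rfl)
    have hu : link p x ∈ chains (n + 1) (below A e (e p) ∩ Set.Ici a) :=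
      chains_mono hS (link_mem_diff hx')
    have hr : link p (cone p x) ∈ chains (n + 1 + 1) (below A e (e p) ∩ Set.Ici a) :=
      chains_mono hS (link_cone_mem_diff hx')
    obtain ⟨w, hw, hwB, hwu⟩ := (hB p hpA).span a _ hu
    have hcyc : bd (link p x - w) = 0 := by rw [map_sub, hwu, sub_self]
    -- Write x = cone p u + r with u = `link p x` and r free of p. As bd (cone p (u - w)) = u - w =
    -- bd y, the boundary of x equals that of cone p w + (y + r), where cone p w is supported on the
    -- basis and y + r has ranks below that of p.
    obtain ⟨y, hy, hyu⟩ := exists_bd_eq (sub_mem hu hw) hcyc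
    obtain ⟨z, hz, hzB, hzx⟩ := ih (e p) (hξ p hpx) (y + link p (cone p x))
      (chains_mono hbelow (add_mem hy hr))
      fun q hq => (show q ∈ below A e (e p) ∩ Set.Ici a from verts_subset (add_mem hy hr) hq).1.2
    refine ⟨cone p w + z, add_mem (cone_mem (S := A ∩ Set.Ici a) ⟨hpA, hpa⟩ (chains_mono hbelow hw)) hz,
      add_mem ?_ hzB, ?_⟩
    · refine map_mem_of_single (fun t ht => ?_) hwB
      have hpt : p ∉ t := fun h => lt_irrefl _ (((hB p hpA).subset ht).2 h).2
      rw [cone_single_of_notMem hpt]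
      exact Finsupp.single_mem_supported ℤ _ ⟨p, hpA, t, ht, rfl⟩
    · have h1 : bd (cone p (link p x - w)) = link p x - w := by
        rw [bd_cone, hcyc, map_zero, sub_zero]
      have h2 := congrArg bd (link_cone_self p x)
      rw [map_add] at h2
      rw [map_add, hzx, map_add, hyu, ← h2, ← h1, map_sub, map_sub]
      abel
  inj := by
    intro z hz h0
    have hzc : z ∈ chains (n + 1 + 1) A := by
      refine Finsupp.supported_mono ?_ hz
      rintro _ ⟨p, hp, t, ht, rfl⟩
      obtain ⟨h1, h2⟩ := (hB p hp).subset ht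
      have hpt : p ∉ t := fun h => lt_irrefl _ (h2 h).2
      refine ⟨by rw [Finset.card_insert_of_notMem hpt, h1], ?_⟩
      rw [Finset.coe_insert]
      exact Set.insert_subset hp fun q hq => (h2 hq).1
    rcases (verts z).eq_empty_or_nonempty with hv | hne
    · exact eq_zero_of_chains_empty (n := n + 1) (mem_chains_of_verts hzc (by simp [hv]))
    exfalso
    obtain ⟨p, hpz, hmax⟩ := (verts z).exists_max_image e hne
    have hpA : p ∈ A := verts_subset hzc hpz
    -- As p has the highest rank in z, a basis simplex of z through p must have p as its own top
    -- vertex, so its face opposite p lies in `B p`.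
    have hw : link p z ∈ Finsupp.supported ℤ ℤ (B p) := by
      have hz' : z ∈ Finsupp.supported ℤ ℤ {s | z s ≠ 0} := by
        rw [Finsupp.mem_supported]
        intro s hs
        simpa using hs
      refine map_mem_of_single (fun s hs => ?_) hz'
      by_cases h : p ∈ s
      · rw [link_single_of_mem h]
        obtain ⟨q, hq, t, ht, rfl⟩ := hz (Finsupp.mem_support_iff.2 hs)
        obtain ⟨-, h2⟩ := (hB q hq).subset ht
        have hqt : q ∉ t := fun h => lt_irrefl _ (h2 h).2
        have hqp : e q ≤ e p := hmax q (mem_verts.2 ⟨_, hs, Finset.mem_insert_self _ _⟩)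
        rcases Finset.mem_insert.1 h with rfl | h
        · rw [Finset.erase_insert hqt]
          exact Finsupp.single_mem_supported ℤ _ ht
        · exact absurd (h2 h).2 hqp.not_gt
      · rw [link_single_of_notMem h]
        exact zero_mem _
    have hdec := link_cone_self p z
    have hr : bd (link p (cone p z)) ∈ chains (n + 1) (A \ {p}) := bd_mem (link_cone_mem_diff hzc)
    have hpA' : p ∉ A \ {p} := fun h => h.2 rfl
    have h1 : link p (bd z) = 0 := by rw [h0, map_zero]
    -- The link at p of the vanishing boundary of z is minus the boundary of `link p z`.
    -- Independence of `B p` then kills this link, so p is no vertex of z after all.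
    rw [← hdec, map_add, map_add, link_eq_zero hpA' hr, zero_add,
      link_bd_cone_of_notMem hpA' (link_mem_diff hzc), neg_eq_zero] at h1
    have h2 := (hB p hpA).inj _ hw h1
    rw [h2, map_zero, add_zero] at hdec
    have := (verts_subset (link_cone_mem_diff (p := p) hzc)) (by rw [hdec]; exact hpz)
    exact this.2 rfl

theorem exists_isChainBasis (n : ℕ) {A : Set J} (hA : #A < ℵ_ n) :
    ∃ B, IsChainBasis n A B := by
  induction n generalizing A with
  | zero =>
    rw [Nat.cast_zero, Cardinal.aleph_zero, Cardinal.lt_aleph0_iff_set_finite] at hA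
    exact exists_isChainBasis_of_finite hA
  | succ n ih =>
    obtain ⟨e, he, hcard⟩ := exists_rank A
    rw [Nat.cast_succ, ← Cardinal.succ_aleph, Order.lt_succ_iff] at hA
    have : ∀ p, ∃ B, p ∈ A → IsChainBasis n (below A e (e p)) B := fun p => by
      by_cases hp : p ∈ A
      · obtain ⟨B, hB⟩ := ih ((hcard p hp).trans_le hA)
        exact ⟨B, fun _ => hB⟩
      · exact ⟨∅, fun h => absurd h hp⟩
    choose B hB using this
    exact ⟨_, exists_isChainBasis_succ he hB⟩

end Basis

/-! ### Boundary maps do not split in large cofinality -/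

section NonSplitting

open Cardinal

variable {J : Type} [LinearOrder J]

/-- Every subset of `A` of size less than `ℵ_n` is strictly bounded in `A`. -/
def HasCofinalityGE (n : ℕ) (A : Set J) : Prop :=
  ∀ S ⊆ A, #S < ℵ_ n → ∃ b ∈ A, ∀ x ∈ S, x < b

theorem hasCofinalityGE_omegaType (n : ℕ) :
    HasCofinalityGE n (Set.univ : Set (OmegaType n)) := by
  intro S _ hS
  have hcof : Order.cof (OmegaType n) = ℵ_ n := by
    rw [Ordinal.cof_toType]
    cases n with
    | zero => rw [Nat.cast_zero, Ordinal.omega_zero, Ordinal.cof_omega0, Cardinal.aleph_zero]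
    | succ n => rw [Nat.cast_succ, Cardinal.cof_omega_add_one]
  by_contra! h
  have : IsCofinal S := fun b => by simpa using h b (Set.mem_univ b)
  exact (hcof ▸ Order.cof_le this).not_gt hS

theorem mk_finset_subset_le {n : ℕ} {S : Set J} (hS : #S ≤ ℵ_ n) :
    #{t : Finset J // (t : Set J) ⊆ S} ≤ ℵ_ n := by
  classical
  have h1 : #{t : Finset J // (t : Set J) ⊆ S} ≤ #(Finset S) := by
    refine Cardinal.mk_le_of_injective (f := fun t => t.1.subtype (· ∈ S)) fun t t' h => ?_
    have := congrArg (Finset.map (Function.Embedding.subtype _)) h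
    simp only [Finset.subtype_map_of_mem t.2, Finset.subtype_map_of_mem t'.2] at this
    exact Subtype.ext this
  refine h1.trans ?_
  rcases finite_or_infinite S with h | h
  · exact (Cardinal.mk_le_aleph0).trans (Cardinal.aleph0_le_aleph _)
  · rwa [Cardinal.mk_finset_of_infinite]

/-- Add to `S` a point and the values of `g` at finite subsets of `S`. -/
def enlarge (b : Set J → J) (g : Finset J → Finset J) (S : Set J) : Set J :=
  S ∪ {b S} ∪ ⋃ t : {t : Finset J // (t : Set J) ⊆ S}, (g t : Set J)

theorem mk_enlarge_le (b : Set J → J) (g : Finset J → Finset J) {n : ℕ} {S : Set J}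
    (hS : #S ≤ ℵ_ n) : #(enlarge b g S) ≤ ℵ_ n := by
  have h0 := Cardinal.aleph0_le_aleph n
  refine (Cardinal.mk_union_le _ _).trans (Cardinal.add_le_of_le h0
    ((Cardinal.mk_union_le _ _).trans (Cardinal.add_le_of_le h0 hS ?_)) ?_)
  · rw [Cardinal.mk_singleton]
    exact Cardinal.one_le_aleph0.trans h0
  · refine (Cardinal.mk_iUnion_le _).trans (Cardinal.mul_le_of_le h0 (mk_finset_subset_le hS) ?_)
    exact ciSup_le' fun t => (Cardinal.mk_le_aleph0).trans h0

/-- The iteration of `enlarge`. -/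
def tower {W : Type} [LinearOrder W] [WellFoundedLT W] (b : Set J → J)
    (g : Finset J → Finset J) (ξ : W) : Set J :=
  ⋃ η : Set.Iio ξ, enlarge b g (tower b g η.1)
termination_by wellFounded_lt.wrap ξ
decreasing_by exact η.2

theorem enlarge_tower_subset {W : Type} [LinearOrder W] [WellFoundedLT W] (b : Set J → J)
    (g : Finset J → Finset J) {η ξ : W} (h : η < ξ) :
    enlarge b g (tower b g η) ⊆ tower b g ξ := by
  rw [tower.eq_1 b g ξ]
  exact Set.subset_iUnion (fun η : Set.Iio ξ => enlarge b g (tower b g η.1)) ⟨η, h⟩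

/-- A closing-off argument of length ω_n: each stage adds a strict upper bound of the preceding one
and the values of g on its finite subsets. A set of size below ℵ_n is caught at one stage because
ω_n is regular, so the next stage bounds it. -/
theorem exists_closed_subset {n : ℕ} {A : Set J} (hA : HasCofinalityGE (n + 1) A)
    {g : Finset J → Finset J} (hg : ∀ t : Finset J, (t : Set J) ⊆ A → (g t : Set J) ⊆ A) :
    ∃ A' ⊆ A, #A' ≤ ℵ_ n ∧ HasCofinalityGE n A' ∧
      ∀ t : Finset J, (t : Set J) ⊆ A' → (g t : Set J) ⊆ A' := by
  have h0 := Cardinal.aleph0_le_aleph n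
  have hlt : ∀ {c : Cardinal}, c ≤ ℵ_ n → c < ℵ_ (n + 1 : ℕ) := fun {c} hc => by
    rwa [Nat.cast_succ, ← Cardinal.succ_aleph, Order.lt_succ_iff]
  obtain ⟨p, -, -⟩ := hA ∅ (Set.empty_subset _) (by
    rw [Cardinal.mk_eq_zero]; exact Cardinal.aleph_pos _)
  have : ∀ S : Set J, ∃ b, S ⊆ A → #S ≤ ℵ_ n → b ∈ A ∧ ∀ x ∈ S, x < b := fun S => by
    by_cases hS : S ⊆ A ∧ #S ≤ ℵ_ n
    · obtain ⟨b, hb, h⟩ := hA S hS.1 (hlt hS.2)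
      exact ⟨b, fun _ _ => ⟨hb, h⟩⟩
    · exact ⟨p, fun h1 h2 => absurd ⟨h1, h2⟩ hS⟩
  choose b hb using this
  have hW : #(OmegaType n) = ℵ_ n := by rw [Cardinal.mk_toType, Ordinal.card_omega]
  have key : ∀ ξ : OmegaType n, tower b g ξ ⊆ A ∧ #(tower b g ξ) ≤ ℵ_ n := fun ξ => by
    induction ξ using WellFoundedLT.induction with
    | _ ξ ih =>
    rw [tower.eq_1]
    constructor
    · refine Set.iUnion_subset fun η => ?_
      obtain ⟨h1, h2⟩ := ih η.1 η.2
      refine Set.union_subset (Set.union_subset h1 ?_) (Set.iUnion_subset fun t => ?_)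
      · exact Set.singleton_subset_iff.2 (hb _ h1 h2).1
      · exact hg t.1 (t.2.trans h1)
    · refine (Cardinal.mk_iUnion_le _).trans (Cardinal.mul_le_of_le h0 ?_ ?_)
      · exact (Cardinal.mk_set_le _).trans hW.le
      · exact ciSup_le' fun η => mk_enlarge_le b g (ih η.1 η.2).2
  have hmono : ∀ {η ξ : OmegaType n}, η < ξ → tower b g η ⊆ tower b g ξ := fun h =>
    (Set.subset_union_left.trans Set.subset_union_left).trans (enlarge_tower_subset b g h)
  have hbdd : ∀ S : Set J, S ⊆ (⋃ ξ : OmegaType n, tower b g ξ) → #S < ℵ_ n →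
      ∃ ξ ξ' : OmegaType n, ξ < ξ' ∧ S ⊆ tower b g ξ := by
    intro S hS hc
    have : ∀ x : S, ∃ ξ : OmegaType n, x.1 ∈ tower b g ξ := fun x => Set.mem_iUnion.1 (hS x.2)
    choose f hf using this
    obtain ⟨ξ, -, hξ⟩ := hasCofinalityGE_omegaType n (Set.range f) (Set.subset_univ _)
      (Cardinal.mk_range_le.trans_lt hc)
    -- A later stage is needed too: the bound and the values of g for stage ξ only appear after ξ.
    obtain ⟨ξ', -, hξ'⟩ := hasCofinalityGE_omegaType n {ξ} (Set.subset_univ _) (by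
      rw [Cardinal.mk_singleton]; exact Cardinal.one_lt_aleph0.trans_le h0)
    exact ⟨ξ, ξ', hξ' ξ rfl, fun x hx => hmono (hξ _ ⟨⟨x, hx⟩, rfl⟩) (hf ⟨x, hx⟩)⟩
  refine ⟨⋃ ξ : OmegaType n, tower b g ξ, Set.iUnion_subset fun ξ => (key ξ).1, ?_, ?_, ?_⟩
  · refine (Cardinal.mk_iUnion_le _).trans (Cardinal.mul_le_of_le h0 hW.le ?_)
    exact ciSup_le' fun ξ => (key ξ).2
  · intro S hS hc
    obtain ⟨ξ, ξ', hlt, hsub⟩ := hbdd S hS hc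
    refine ⟨b (tower b g ξ), Set.mem_iUnion.2 ⟨ξ', ?_⟩, fun x hx =>
      (hb _ (key ξ).1 (key ξ).2).2 x (hsub hx)⟩
    exact enlarge_tower_subset b g hlt (Or.inl (Or.inr rfl))
  · intro t ht
    obtain ⟨ξ, ξ', hlt, hsub⟩ := hbdd t ht (by
      exact (Cardinal.lt_aleph0_of_finite _).trans_le h0)
    refine Set.Subset.trans ?_ (Set.subset_iUnion _ ξ')
    refine Set.Subset.trans ?_ (enlarge_tower_subset b g hlt)
    exact (Set.subset_iUnion (fun t : {t : Finset J // (t : Set J) ⊆ tower b g ξ} =>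
      (g t : Set J)) ⟨t, hsub⟩).trans Set.subset_union_right

/-- The map `s` splits the boundary on `(n+1)`-element chains of `A`, compatibly with the
restrictions to the sets `A ∩ [a, ∞)`. -/
structure IsSplitting (n : ℕ) (A : Set J) (s : Chain J →ₗ[ℤ] Chain J) : Prop where
  mem : ∀ a ∈ A, ∀ x ∈ chains (n + 1) (A ∩ Set.Ici a), s x ∈ chains (n + 1) (A ∩ Set.Ici a)
  bd_apply : ∀ x ∈ chains (n + 1) A, bd (s x) = bd x
  apply_cycle : ∀ x ∈ chains (n + 1) A, bd x = 0 → s x = 0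

/-- Differences of vertices are augmented cycles, so s has the same value at all vertices. This
value lies in every tail, hence is zero, although its augmentation is 1. -/
theorem not_isSplitting_zero {A : Set J} (hA : HasCofinalityGE 0 A)
    (s : Chain J →ₗ[ℤ] Chain J) : ¬ IsSplitting 0 A s := by
  intro h
  have hA' : ∀ S : Finset J, (S : Set J) ⊆ A → ∃ b ∈ A, ∀ x ∈ S, x < b := fun S hS =>
    hA S hS (by
      rw [Nat.cast_zero, Cardinal.aleph_zero]
      exact Cardinal.lt_aleph0_of_finite _)
  obtain ⟨a, ha, -⟩ := hA' ∅ (by simp)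
  have hmem : ∀ b ∈ A, Finsupp.single {b} 1 ∈ chains (0 + 1) (A ∩ Set.Ici b) := fun b hb =>
    single_mem_chains rfl (by simpa using hb) 1
  have hs := h.mem a ha _ (hmem a ha)
  obtain ⟨b, hb, hlt⟩ := hA' (verts (s (Finsupp.single {a} 1)))
    ((verts_subset hs).trans Set.inter_subset_left)
  have heq : s (Finsupp.single {a} 1) = s (Finsupp.single {b} 1) := by
    rw [← sub_eq_zero, ← map_sub]
    refine h.apply_cycle _ (sub_mem (chains_mono Set.inter_subset_left (hmem a ha))
      (chains_mono Set.inter_subset_left (hmem b hb))) ?_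
    rw [map_sub, bd_singleton, bd_singleton, sub_self]
  have h0 : s (Finsupp.single {a} 1) ∈ chains (0 + 1) (∅ : Set J) := by
    refine mem_chains_of_verts hs fun q hq => ?_
    have : q ∈ A ∩ Set.Ici b := by
      rw [heq] at hq
      exact verts_subset (h.mem b hb _ (hmem b hb)) hq
    exact absurd (hlt q hq) this.2.not_gt
  have h1 := h.bd_apply _ (chains_mono Set.inter_subset_left (hmem a ha))
  rw [eq_zero_of_chains_empty h0, map_zero, bd_singleton] at h1
  exact one_ne_zero (Finsupp.single_eq_zero.1 h1.symm)

/-- A splitting in one dimension descends to the next lower dimension on a smaller set A' closed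
under s: cone off from a point p above A', apply s, project back to A' and take the boundary.
Removing the result from the identity gives a splitting on A'. -/
theorem not_isSplitting {n : ℕ} {A : Set J} (hA : HasCofinalityGE n A)
    (s : Chain J →ₗ[ℤ] Chain J) : ¬ IsSplitting n A s := by
  induction n generalizing A s with
  | zero => exact not_isSplitting_zero hA s
  | succ n ih =>
    classical
    intro h
    have hmem : ∀ {x}, x ∈ chains (n + 1 + 1) A → s x ∈ chains (n + 1 + 1) A := fun {x} hx => by
      refine map_mem_of_single (fun t ht => ?_) hx
      have hne : t.Nonempty := Finset.card_pos.1 (by rw [ht.1]; omega)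
      refine chains_mono Set.inter_subset_left (h.mem (t.min' hne) (ht.2 (t.min'_mem hne)) _
        (single_mem_chains ht.1 (Set.subset_inter ht.2 fun y hy => t.min'_le y hy) 1))
    -- Closure under g means that s maps chains on A' to chains on A'.
    obtain ⟨A', hA', hcard, hcof, hcl⟩ := exists_closed_subset hA
      (g := fun t => if t.card = n + 1 + 1 then verts (s (Finsupp.single t 1)) else ∅) (by
        intro t ht
        split_ifs with hc
        · exact verts_subset (hmem (single_mem_chains hc ht 1))
        · simp)
    have hs' : ∀ {x}, x ∈ chains (n + 1 + 1) A' → s x ∈ chains (n + 1 + 1) A' := fun {x} hx => by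
      refine map_mem_of_single (fun t ht => ?_) hx
      have := hcl t ht.2
      rw [if_pos ht.1] at this
      exact mem_chains_of_verts (hmem (single_mem_chains ht.1 (ht.2.trans hA') 1)) this
    obtain ⟨p, hp, hpA'⟩ := hA A' hA' (by
      rwa [Nat.cast_succ, ← Cardinal.succ_aleph, Order.lt_succ_iff])
    refine ih hcof (LinearMap.id - bd ∘ₗ restr A' ∘ₗ s ∘ₗ cone p) ⟨?_, ?_, ?_⟩
    · intro a ha x hx
      refine sub_mem hx (bd_mem (n := n + 1) ?_)
      -- Since p lies above all of A', coning from p does not leave the tail at a; this is what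
      -- makes the new map compatible with tails.
      have h1 : cone p x ∈ chains (n + 1 + 1) (A ∩ Set.Ici a) :=
        cone_mem (S := A ∩ Set.Ici a) ⟨hp, (hpA' a ha).le⟩ (chains_mono (Set.inter_subset_inter_left _ hA') hx)
      refine chains_mono ?_ (restr_mem (S := A') (h.mem a (hA' ha) _ h1))
      exact fun q hq => ⟨hq.1, hq.2.2⟩
    · intro x hx
      simp only [LinearMap.sub_apply, LinearMap.id_apply, LinearMap.comp_apply, map_sub, bd_bd,
        sub_zero]
    · intro x hx hx0
      -- A cycle x bounds some y inside A'. The chains cone p x and y differ by a cycle, so s agrees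
      -- on them, and s y already lies on A', where the projection is the identity.
      obtain ⟨y, hy, hyx⟩ := exists_bd_eq hx hx0
      have h1 : s (cone p x) = s y := by
        rw [← sub_eq_zero, ← map_sub]
        refine h.apply_cycle _ (sub_mem (cone_mem hp (chains_mono hA' hx)) (chains_mono hA' hy)) ?_
        rw [map_sub, bd_cone, hx0, map_zero, sub_zero, hyx, sub_self]
      simp only [LinearMap.sub_apply, LinearMap.id_apply, LinearMap.comp_apply]
      rw [h1, restr_eq_self (hs' hy), h.bd_apply y (chains_mono hA' hy), hyx, sub_self]

end NonSplitting

/-! ### Inverse systems of subgroups and their morphisms -/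

section SubSystems

variable {J : Type} [LinearOrder J] {M M' : Type} [AddCommGroup M] [AddCommGroup M']

/-- The inverse system of a decreasing family of subgroups. -/
def subSys (N : J → AddSubgroup M) (hN : Antitone N) : Sys J where
  obj a := AddCommGrpCat.of (N a.unop)
  map f := AddCommGrpCat.ofHom (AddSubgroup.inclusion (hN (leOfHom f.unop)))

variable {N : J → AddSubgroup M} {hN : Antitone N} {N' : J → AddSubgroup M'} {hN' : Antitone N'}
  {X Y : Sys J}

/-- The bonding maps of an inverse system. -/
def bond (Y : Sys J) {a b : J} (h : a ≤ b) : Y.obj (op b) →+ Y.obj (op a) :=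
  (Y.map (homOfLE h).op).hom

/-- The components of a morphism of inverse systems. -/
def component (g : X ⟶ Y) (a : J) : X.obj (op a) →+ Y.obj (op a) := (g.app (op a)).hom

theorem component_bond (g : X ⟶ Y) {a b : J} (h : a ≤ b) (x : X.obj (op b)) :
    component g a (bond X h x) = bond Y h (component g b x) :=
  NatTrans.naturality_apply g (homOfLE h).op x

theorem sys_hom_ext {g h : X ⟶ Y} (H : ∀ a x, component g a x = component h a x) : g = h := by
  ext a x
  exact H a.unop x

/-- The value of a morphism from a system of subgroups. -/
def value (g : subSys N hN ⟶ Y) (a : J) : N a →+ Y.obj (op a) := component g a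

theorem subSys_hom_ext {g h : subSys N hN ⟶ Y} (H : ∀ a x, value g a x = value h a x) : g = h :=
  sys_hom_ext H

theorem bond_value (g : subSys N hN ⟶ Y) {a b : J} (h : a ≤ b) {x : M} (hx : x ∈ N b) :
    bond Y h (value g b ⟨x, hx⟩) = value g a ⟨x, hN h hx⟩ :=
  (component_bond g h (⟨x, hx⟩ : N b)).symm

@[simp]
theorem value_comp (g : subSys N hN ⟶ X) (h : X ⟶ Y) (a : J) (x : N a) :
    value (g ≫ h) a x = component h a (value g a x) := rfl

@[simp]
theorem value_zero (a : J) (x : N a) : value (0 : subSys N hN ⟶ Y) a x = 0 := rfl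

/-- A morphism from a system of subgroups given by its values. -/
def homMk (f : ∀ a, N a →+ Y.obj (op a))
    (hf : ∀ a b (h : a ≤ b) x (hx : x ∈ N b), f a ⟨x, hN h hx⟩ = bond Y h (f b ⟨x, hx⟩)) :
    subSys N hN ⟶ Y where
  app a := AddCommGrpCat.ofHom (f a.unop)
  naturality {b a} i := by
    ext x
    exact hf a.unop b.unop (leOfHom i.unop) x.1 x.2

/-- The morphism of systems of subgroups induced by a homomorphism. -/
def subSysMap (f : M →+ M') (hf : ∀ a, ∀ x ∈ N a, f x ∈ N' a) : subSys N hN ⟶ subSys N' hN' :=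
  homMk (fun a => (f.comp (N a).subtype).codRestrict (N' a) fun x => hf a x.1 x.2)
    fun _ _ _ _ _ => rfl

end SubSystems

/-! ### The projective resolution by chains and derived limits -/

section Resolution

variable {J : Type} [LinearOrder J] {X Y : Sys J}

/-- The `n`-element chains on `[a, ∞)`. -/
def chainGroup (J : Type) [LinearOrder J] (n : ℕ) (a : J) : AddSubgroup (Chain J) :=
  (chains n (Set.Ici a)).toAddSubgroup

/-- The cycles among the `n`-element chains on `[a, ∞)`. -/
def cycleGroup (J : Type) [LinearOrder J] (n : ℕ) (a : J) : AddSubgroup (Chain J) :=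
  (chains n (Set.Ici a) ⊓ LinearMap.ker bd).toAddSubgroup

theorem antitone_chainGroup (n : ℕ) : Antitone (chainGroup J n) :=
  fun _ _ h _ hx => chains_mono (Set.Ici_subset_Ici.2 h) hx

theorem antitone_cycleGroup (n : ℕ) : Antitone (cycleGroup J n) :=
  fun _ _ h _ hx => ⟨chains_mono (Set.Ici_subset_Ici.2 h) hx.1, hx.2⟩

theorem cycleGroup_le {n : ℕ} {a : J} : cycleGroup J n a ≤ chainGroup J n a := fun _ hx => hx.1

/-- The system of augmented chains. -/
abbrev CSys (J : Type) [LinearOrder J] (n : ℕ) : Sys J :=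
  subSys (chainGroup J n) (antitone_chainGroup n)

/-- The system of cycles. -/
abbrev ZSys (J : Type) [LinearOrder J] (n : ℕ) : Sys J :=
  subSys (cycleGroup J n) (antitone_cycleGroup n)

theorem bd_mem_cycleGroup {n : ℕ} {a : J} {x : Chain J} (hx : x ∈ chainGroup J (n + 1) a) :
    bd x ∈ cycleGroup J n a :=
  ⟨bd_mem hx, bd_bd x⟩

theorem cone_mem_chainGroup {n : ℕ} {a : J} {x : Chain J} (hx : x ∈ chainGroup J n a) :
    cone a x ∈ chainGroup J (n + 1) a :=
  cone_mem (S := Set.Ici a) le_rfl hx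

theorem bd_cone_of_mem {n : ℕ} {a : J} {x : Chain J} (hx : x ∈ cycleGroup J n a) (p : J) :
    bd (cone p x) = x := by
  rw [bd_cone, show bd x = 0 from hx.2, map_zero, sub_zero]

/-- The inclusion of the cycles. -/
def cycleIncl (J : Type) [LinearOrder J] (n : ℕ) : ZSys J n ⟶ CSys J n :=
  subSysMap (AddMonoidHom.id _) fun _ _ hx => hx.1

/-- The boundary map onto the cycles. -/
def toCycle (J : Type) [LinearOrder J] (n : ℕ) : CSys J (n + 1) ⟶ ZSys J n :=
  subSysMap bd.toAddMonoidHom fun _ _ hx => bd_mem_cycleGroup hx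

@[simp]
theorem value_cycleIncl_comp {n : ℕ} (g : CSys J n ⟶ Y) (a : J) {x : Chain J}
    (hx : x ∈ cycleGroup J n a) :
    value (cycleIncl J n ≫ g) a ⟨x, hx⟩ = value g a ⟨x, hx.1⟩ := rfl

@[simp]
theorem value_toCycle_comp {n : ℕ} (g : ZSys J n ⟶ Y) (a : J) {x : Chain J}
    (hx : x ∈ chainGroup J (n + 1) a) :
    value (toCycle J n ≫ g) a ⟨x, hx⟩ = value g a ⟨bd x, bd_mem_cycleGroup hx⟩ := rfl

instance (n : ℕ) : Mono (cycleIncl J n) := by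
  have : ∀ a, Mono ((cycleIncl J n).app a) := fun a => by
    rw [AddCommGrpCat.mono_iff_injective]
    intro x y h
    exact Subtype.ext (congrArg (fun z : chainGroup J n a.unop => z.1) h)
  exact NatTrans.mono_of_mono_app _

/-- A morphism on chains which vanishes on cycles factors through the boundary map. -/
theorem exists_toCycle_comp_eq {n : ℕ} (g : CSys J (n + 1) ⟶ Y)
    (hg : cycleIncl J (n + 1) ≫ g = 0) : ∃ h : ZSys J n ⟶ Y, toCycle J n ≫ h = g := by
  have key : ∀ a x y (hx : x ∈ chainGroup J (n + 1) a) (hy : y ∈ chainGroup J (n + 1) a),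
      bd x = bd y → value g a ⟨x, hx⟩ = value g a ⟨y, hy⟩ := fun a x y hx hy h => by
    have hxy : x - y ∈ cycleGroup J (n + 1) a :=
      ⟨sub_mem hx hy, by
        change bd (x - y) = 0
        rw [map_sub, h, sub_self]⟩
    have := value_cycleIncl_comp g a hxy
    rw [hg, value_zero] at this
    rw [← sub_eq_zero, ← map_sub]
    exact this.symm
  -- The cone with apex a provides a preimage of a cycle over a. The apex changes with a, but by
  -- `key` the value depends only on the boundary, so the maps are compatible.
  refine ⟨homMk (fun a => (value g a).comp
    (((cone a).toAddMonoidHom.comp (cycleGroup J n a).subtype).codRestrict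
      (chainGroup J (n + 1) a) fun x => cone_mem_chainGroup (cycleGroup_le x.2))) ?_, ?_⟩
  · intro a b h x hx
    change value g a ⟨cone a x, _⟩ = bond Y h (value g b ⟨cone b x, _⟩)
    refine (key a _ _ _ (antitone_chainGroup _ h (cone_mem_chainGroup (cycleGroup_le hx))) ?_).trans
      (bond_value g h (cone_mem_chainGroup (cycleGroup_le hx))).symm
    rw [bd_cone_of_mem hx, bd_cone_of_mem hx]
  · refine subSys_hom_ext fun a x => ?_
    change value g a ⟨cone a (bd x.1), _⟩ = value g a ⟨x.1, x.2⟩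
    exact key a _ _ _ _ (bd_cone_of_mem (bd_mem_cycleGroup x.2) a)

theorem toCycle_cancel {n : ℕ} {g h : ZSys J n ⟶ Y} (H : toCycle J n ≫ g = toCycle J n ≫ h) :
    g = h := by
  refine subSys_hom_ext fun a x => ?_
  have := congrArg (fun f => value f a ⟨cone a x.1, cone_mem_chainGroup (cycleGroup_le x.2)⟩) H
  simp only [value_toCycle_comp] at this
  have hx : (⟨bd (cone a x.1), bd_mem_cycleGroup (cone_mem_chainGroup (cycleGroup_le x.2))⟩ :
      cycleGroup J n a) = x := Subtype.ext (bd_cone_of_mem x.2 a)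
  rwa [hx] at this

theorem single_mem_chainGroup {n : ℕ} {s : Finset J} (hs : s.card = n) {a : J}
    (ha : ∀ q ∈ s, a ≤ q) (c : ℤ) : Finsupp.single s c ∈ chainGroup J n a :=
  single_mem_chains hs (fun q hq => ha q hq) c

theorem nonempty_of_card {n : ℕ} {s : Finset J} (hs : s.card = n + 1) : s.Nonempty :=
  Finset.card_pos.1 (by omega)

/-- Two homomorphisms on a group of chains agree if they do so on all simplices. -/
theorem chainGroup_hom_ext {n : ℕ} {a : J} {G : Type*} [AddCommGroup G]
    {f g : chainGroup J n a →+ G}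
    (h : ∀ (s : Finset J) (hs : s.card = n) (ha : ∀ q ∈ s, a ≤ q),
      f ⟨_, single_mem_chainGroup hs ha 1⟩ = g ⟨_, single_mem_chainGroup hs ha 1⟩)
    (x : chainGroup J n a) : f x = g x := by
  have key : chains n (Set.Ici a) ≤
      ((f.eqLocus g).map (chainGroup J n a).subtype).toIntSubmodule := by
    refine supported_induction fun s hs => ?_
    exact ⟨⟨_, single_mem_chainGroup hs.1 (fun q hq => hs.2 hq) 1⟩, h s hs.1 fun q hq => hs.2 hq,
      rfl⟩
  obtain ⟨y, hy, hyx⟩ := key x.2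
  rwa [← show y = x from Subtype.ext hyx]

theorem chainGroup_ext {n : ℕ} {g h : CSys J (n + 1) ⟶ Y}
    (H : ∀ (s : Finset J) (hs : s.card = n + 1),
      value g (s.min' (nonempty_of_card hs))
        ⟨_, single_mem_chainGroup hs (fun q hq => s.min'_le q hq) 1⟩ =
      value h (s.min' (nonempty_of_card hs))
        ⟨_, single_mem_chainGroup hs (fun q hq => s.min'_le q hq) 1⟩) : g = h := by
  refine subSys_hom_ext fun a x => chainGroup_hom_ext (fun s hs ha => ?_) x
  have hle : a ≤ s.min' (nonempty_of_card hs) := Finset.le_min' _ _ _ ha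
  have := congrArg (bond Y hle) (H s hs)
  rwa [bond_value, bond_value] at this

/-- Freeness: a simplex lives in the tail at a exactly when a is at most its least vertex, so it
generates a representable summand and Yoneda applies. -/
theorem exists_hom_of_family {n : ℕ} (v : ∀ s : Finset J, ∀ hs : s.card = n + 1,
      Y.obj (op (s.min' (nonempty_of_card hs)))) :
    ∃ g : CSys J (n + 1) ⟶ Y, ∀ (s : Finset J) (hs : s.card = n + 1),
      value g (s.min' (nonempty_of_card hs))
        ⟨_, single_mem_chainGroup hs (fun q hq => s.min'_le q hq) 1⟩ = v s hs := by
  classical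
  let f : ∀ a : J, Chain J →+ Y.obj (op a) := fun a => Finsupp.liftAddHom fun s =>
    if h : ∃ hs : s.card = n + 1, a ≤ s.min' (nonempty_of_card hs) then
      zmultiplesHom _ (bond Y h.2 (v s h.1)) else 0
  have hf : ∀ (a : J) (s : Finset J) (hs : s.card = n + 1)
      (ha : a ≤ s.min' (nonempty_of_card hs)), f a (Finsupp.single s 1) = bond Y ha (v s hs) := by
    intro a s hs ha
    have h : ∃ hs : s.card = n + 1, a ≤ s.min' (nonempty_of_card hs) := ⟨hs, ha⟩
    simp only [f, Finsupp.liftAddHom_apply_single, dif_pos h]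
    rw [zmultiplesHom_apply, one_zsmul]
  refine ⟨homMk (fun a => (f a).comp (chainGroup J (n + 1) a).subtype) ?_, ?_⟩
  · intro a b h x hx
    refine chainGroup_hom_ext (a := b)
      (f := (f a).comp (chainGroup J (n + 1) b).subtype)
      (g := (bond Y h).comp ((f b).comp (chainGroup J (n + 1) b).subtype)) ?_ ⟨x, hx⟩
    intro s hs hb
    have hle := Finset.le_min' s (nonempty_of_card hs) b hb
    change f a (Finsupp.single s 1) = bond Y h (f b (Finsupp.single s 1))
    rw [hf a s hs (h.trans hle), hf b s hs hle]
    change (Y.map _).hom _ = (Y.map _).hom ((Y.map _).hom _)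
    rw [← AddCommGrpCat.comp_apply, ← Y.map_comp]
    rfl
  · intro s hs
    change f _ (Finsupp.single s 1) = _
    rw [hf _ s hs le_rfl]
    change (Y.map (𝟙 _)).hom _ = _
    rw [Y.map_id]
    rfl

/-- The systems of chains are projective. -/
theorem exists_lift {n : ℕ} (p : X ⟶ Y) (g : CSys J (n + 1) ⟶ Y)
    (h : ∀ a x, ∃ y, component p a y = value g a x) : ∃ l : CSys J (n + 1) ⟶ X, l ≫ p = g := by
  choose v hv using fun (s : Finset J) (hs : s.card = n + 1) =>
    h (s.min' (nonempty_of_card hs)) ⟨_, single_mem_chainGroup hs (fun q hq => s.min'_le q hq) 1⟩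
  obtain ⟨l, hl⟩ := exists_hom_of_family v
  refine ⟨l, chainGroup_ext fun s hs => ?_⟩
  rw [value_comp, hl]
  exact hv s hs

/-- A pointwise exact pair of morphisms. -/
def PointwiseExact {X Y Z : Sys J} (f : X ⟶ Y) (g : Y ⟶ Z) : Prop :=
  ∀ a y, component g a y = 0 → ∃ x, component f a x = y

theorem pointwiseExact_of_exact (S : ShortComplex (Sys J)) (h : S.Exact) :
    PointwiseExact S.f S.g := fun a y hy => by
  have := h.map ((evaluation Jᵒᵖ AddCommGrpCat.{0}).obj (op a))
  rw [ShortComplex.ab_exact_iff] at this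
  exact this y hy

/-- One step of dimension shifting. Injectivity extends φ to some h on chains; h followed by d₁
factors through Z_m and lifts along d₁ by `H`. Subtracting the lift leaves the values on cycles
unchanged and makes h land in the kernel of d₁, so projectivity lifts it to Y₀. -/
theorem exists_extension_of_exact {m : ℕ} {Y₀ Y₁ Y₂ Y₃ : Sys J} [Injective Y₁] {d₀ : Y₀ ⟶ Y₁}
    {d₁ : Y₁ ⟶ Y₂} {d₂ : Y₂ ⟶ Y₃} (h₁₂ : d₁ ≫ d₂ = 0) (hex : PointwiseExact d₀ d₁)
    (H : ∀ φ : ZSys J m ⟶ Y₂, φ ≫ d₂ = 0 → ∃ l : ZSys J m ⟶ Y₁, l ≫ d₁ = φ)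
    (φ : ZSys J (m + 1) ⟶ Y₁) (hφ : φ ≫ d₁ = 0) :
    ∃ ψ : CSys J (m + 1) ⟶ Y₀, cycleIncl J (m + 1) ≫ ψ ≫ d₀ = φ := by
  have hh : cycleIncl J (m + 1) ≫ Injective.factorThru φ (cycleIncl J (m + 1)) = φ :=
    Injective.comp_factorThru _ _
  generalize Injective.factorThru φ (cycleIncl J (m + 1)) = h at hh
  obtain ⟨g, hg⟩ := exists_toCycle_comp_eq (h ≫ d₁) (by rw [← Category.assoc, hh, hφ])
  obtain ⟨l, hl⟩ := H g (toCycle_cancel (by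
    rw [← Category.assoc, hg, Category.assoc, h₁₂, comp_zero, comp_zero]))
  have h0 : (h - toCycle J m ≫ l) ≫ d₁ = 0 := by
    rw [Preadditive.sub_comp, Category.assoc, hl, hg, sub_self]
  have hz : cycleIncl J (m + 1) ≫ toCycle J m = 0 := by
    refine subSys_hom_ext fun a x => ?_
    exact Subtype.ext x.2.2
  obtain ⟨ψ, hψ⟩ := exists_lift d₀ (h - toCycle J m ≫ l) fun a x => by
    refine hex a _ ?_
    rw [← value_comp, h0, value_zero]
  refine ⟨ψ, ?_⟩
  rw [hψ, Preadditive.comp_sub, hh, ← Category.assoc, hz, zero_comp, sub_zero]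

theorem empty_mem_cycleGroup (a : J) : Finsupp.single (∅ : Finset J) (1 : ℤ) ∈ cycleGroup J 0 a :=
  ⟨single_mem_chains rfl (by simp) 1, by
    change bd _ = 0
    rw [bd_single, Finset.sum_empty]⟩

theorem eq_smul_empty {a : J} (x : cycleGroup J 0 a) :
    x = x.1 ∅ • (⟨_, empty_mem_cycleGroup a⟩ : cycleGroup J 0 a) := by
  refine Subtype.ext ((eq_single_empty x.2.1).trans ?_)
  simp

/-- The cone with apex `ℤ` given by a morphism from the constant system. -/
def constCone (φ : ZSys J 0 ⟶ Y) : Cone Y where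
  pt := AddCommGrpCat.of ℤ
  π :=
    { app := fun a => AddCommGrpCat.ofHom
        (zmultiplesHom _ (value φ a.unop ⟨_, empty_mem_cycleGroup a.unop⟩))
      naturality := fun a b f => by
        refine AddCommGrpCat.hom_ext (AddMonoidHom.ext fun x : ℤ => ?_)
        change x • value φ b.unop ⟨_, empty_mem_cycleGroup b.unop⟩ =
          bond Y (leOfHom f.unop) (x • value φ a.unop ⟨_, empty_mem_cycleGroup a.unop⟩)
        rw [map_zsmul, bond_value φ (leOfHom f.unop) (empty_mem_cycleGroup a.unop)] }

/-- The element of the limit given by a morphism from the constant system. -/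
def limitElement (φ : ZSys J 0 ⟶ Y) : (lim.obj Y : AddCommGrpCat.{0}) :=
  (limit.lift Y (constCone φ)).hom (1 : ℤ)

theorem π_limitElement (φ : ZSys J 0 ⟶ Y) (a : J) :
    (limit.π Y (op a)).hom (limitElement φ) = value φ a ⟨_, empty_mem_cycleGroup a⟩ := by
  have := congrArg (fun f => f.hom (1 : ℤ)) (limit.lift_π (constCone φ) (op a))
  exact this.trans (one_zsmul (value φ a ⟨_, empty_mem_cycleGroup a⟩))

theorem limit_element_ext {u v : (lim.obj Y : AddCommGrpCat.{0})}
    (h : ∀ a : J, (limit.π Y (op a)).hom u = (limit.π Y (op a)).hom v) : u = v :=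
  Concrete.limit_ext Y u v fun a => h a.unop

theorem eq_zero_of_isZero_lim (h : IsZero (lim.obj Y : AddCommGrpCat.{0})) (φ : ZSys J 0 ⟶ Y) :
    φ = 0 := by
  refine subSys_hom_ext fun a x => ?_
  have h1 : limit.π Y (op a) = 0 := h.eq_of_src _ _
  have h2 := π_limitElement φ a
  rw [h1] at h2
  rw [eq_smul_empty x, map_zsmul, ← h2]
  simp

/-- The morphism from the constant system given by an element of the limit. -/
def ofLimitElement (u : (lim.obj Y : AddCommGrpCat.{0})) : ZSys J 0 ⟶ Y :=
  homMk (fun a => (zmultiplesHom _ ((limit.π Y (op a)).hom u)).comp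
    ((Finsupp.applyAddHom ∅).comp (cycleGroup J 0 a).subtype)) (by
      intro a b h x hx
      change x ∅ • _ = bond Y h (x ∅ • _)
      rw [map_zsmul]
      congr 1
      exact (congrArg (fun f => f.hom u) (limit.w Y (homOfLE h).op)).symm)

theorem value_ofLimitElement (u : (lim.obj Y : AddCommGrpCat.{0})) (a : J) (x : cycleGroup J 0 a) :
    value (ofLimitElement u) a x = x.1 ∅ • (limit.π Y (op a)).hom u := rfl

/-- Morphisms from Z_0, the constant system ℤ, are elements of the limit, so exactness of limits is
a lifting property for Z_0. -/
theorem exists_lift_of_lim_exact {Y₁ Y₂ Y₃ : Sys J} {d₁ : Y₁ ⟶ Y₂} {d₂ : Y₂ ⟶ Y₃}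
    (hex : ∀ v : (lim.obj Y₂ : AddCommGrpCat.{0}), (lim.map d₂).hom v = 0 →
      ∃ u : (lim.obj Y₁ : AddCommGrpCat.{0}), (lim.map d₁).hom u = v)
    (φ : ZSys J 0 ⟶ Y₂) (hφ : φ ≫ d₂ = 0) : ∃ l : ZSys J 0 ⟶ Y₁, l ≫ d₁ = φ := by
  have hπ : ∀ {A B : Sys J} (d : A ⟶ B) (w : (lim.obj A : AddCommGrpCat.{0})) (a : J),
      (limit.π B (op a)).hom ((lim.map d).hom w) = component d a ((limit.π A (op a)).hom w) :=
    fun d w a => congrArg (fun f => f.hom w) (limMap_π d (op a))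
  obtain ⟨u, hu⟩ := hex (limitElement φ) (limit_element_ext fun a => by
    rw [hπ, π_limitElement, ← value_comp, hφ, value_zero, map_zero])
  refine ⟨ofLimitElement u, subSys_hom_ext fun a x => ?_⟩
  rw [value_comp, value_ofLimitElement, map_zsmul, ← hπ, hu, π_limitElement, ← map_zsmul,
    ← eq_smul_empty]

theorem lim_exact_of_isZero {n : ℕ} {X : Sys J} (I : InjectiveResolution X)
    (h : IsZero ((limDer J (n + 1)).obj X)) (v : (lim.obj (I.cocomplex.X (n + 1)) :))
    (hv : (lim.map (I.cocomplex.d (n + 1) (n + 2))).hom v = 0) :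
    ∃ u : (lim.obj (I.cocomplex.X n) :), (lim.map (I.cocomplex.d n (n + 1))).hom u = v := by
  have h1 := h.of_iso (I.isoRightDerivedObj lim (n + 1)).symm
  have h2 := (HomologicalComplex.exactAt_iff_isZero_homology _ _).2 h1
  rw [HomologicalComplex.exactAt_iff' _ n (n + 1) (n + 2) (by simp)
    (by simp only [CochainComplex.next]; rfl), ShortComplex.ab_exact_iff] at h2
  exact h2 v hv

/-- If `lim^{n+1} X = 0` then morphisms from cycles to `X` extend to chains. -/
theorem exists_extension_of_isZero {n : ℕ} {X : Sys J} (h : IsZero ((limDer J (n + 1)).obj X))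
    (φ : ZSys J (n + 1) ⟶ X) : ∃ ψ : CSys J (n + 1) ⟶ X, cycleIncl J (n + 1) ≫ ψ = φ := by
  let I : InjectiveResolution X := injectiveResolution X
  have hd : ∀ j, I.cocomplex.d j (j + 1) ≫ I.cocomplex.d (j + 1) (j + 2) = 0 :=
    fun j => I.complex_d_comp j
  -- Shifting trades cycle dimension m against resolution degree j. At m = 0 the claim is exactness
  -- of the limit complex in degree n + 1, which is the hypothesis; the case j = 0 is used at the
  -- end.
  have key : ∀ m j, m + j = n → ∀ φ : ZSys J m ⟶ I.cocomplex.X (j + 1),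
      φ ≫ I.cocomplex.d (j + 1) (j + 2) = 0 →
        ∃ l : ZSys J m ⟶ I.cocomplex.X j, l ≫ I.cocomplex.d j (j + 1) = φ := by
    intro m
    induction m with
    | zero =>
      intro j hj
      obtain rfl : j = n := by omega
      exact exists_lift_of_lim_exact (lim_exact_of_isZero I h)
    | succ m ih =>
      intro j hj φ hφ
      have hex : PointwiseExact (I.cocomplex.d j (j + 1)) (I.cocomplex.d (j + 1) (j + 2)) :=
        pointwiseExact_of_exact _ (I.exact_succ j)
      obtain ⟨ψ, hψ⟩ := exists_extension_of_exact (hd (j + 1)) hex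
        (ih (j + 1) (by omega)) φ hφ
      exact ⟨cycleIncl J (m + 1) ≫ ψ, by rw [Category.assoc, hψ]⟩
  obtain ⟨ι, hι, hex, hι0⟩ : ∃ ι : X ⟶ I.cocomplex.X 0, Mono ι ∧
      PointwiseExact ι (I.cocomplex.d 0 1) ∧ ι ≫ I.cocomplex.d 0 1 = 0 :=
    ⟨I.ι.f 0, inferInstanceAs (Mono (I.ι.f 0)), pointwiseExact_of_exact _ I.exact₀,
      I.ι_f_zero_comp_complex_d⟩
  obtain ⟨ψ, hψ⟩ := exists_extension_of_exact (hd 0) hex (key n 0 rfl) (φ ≫ ι) (by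
    rw [Category.assoc, hι0, comp_zero])
  exact ⟨ψ, by rwa [← cancel_mono ι, Category.assoc]⟩

/-- If `lim X = 0` then morphisms from the constant system to `X` vanish. -/
theorem eq_zero_of_isZero {X : Sys J} (h : IsZero ((limDer J 0).obj X)) (φ : ZSys J 0 ⟶ X) :
    φ = 0 :=
  eq_zero_of_isZero_lim (h.of_iso (lim.rightDerivedZeroIsoSelf.app X).symm) φ

end Resolution

/-! ### Increasing tuples versus finite subsets -/

section Tuples

variable {J : Type} [LinearOrder J]

/-- The set of coordinates of a tuple. -/
def Tuple.coords {n : ℕ} (t : Tuple J n) : Finset J := Finset.univ.map t.toEmbedding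

theorem Tuple.mem_coords {n : ℕ} {t : Tuple J n} {q : J} : q ∈ t.coords ↔ ∃ i, t i = q := by
  simp [Tuple.coords]

theorem Tuple.card_coords {n : ℕ} (t : Tuple J n) : t.coords.card = n + 1 := by
  simp [Tuple.coords]

theorem Tuple.coords_injective (n : ℕ) :
    Function.Injective (Tuple.coords : Tuple J n → Finset J) := fun t t' h => by
  have h1 := Finset.orderEmbOfFin_unique' t.card_coords (f := t) fun i =>
    Tuple.mem_coords.2 ⟨i, rfl⟩
  have h2 := Finset.orderEmbOfFin_unique' t.card_coords (f := t') fun i =>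
    h ▸ Tuple.mem_coords.2 ⟨i, rfl⟩
  rw [h1, h2]

theorem Tuple.exists_coords_eq {n : ℕ} {s : Finset J} (hs : s.card = n + 1) :
    ∃ t : Tuple J n, t.coords = s :=
  ⟨s.orderEmbOfFin hs, by
    ext q
    rw [Tuple.mem_coords, ← Set.mem_range, Finset.range_orderEmbOfFin, Finset.mem_coe]⟩

theorem Tuple.coords_face {n : ℕ} (t : Tuple J (n + 1)) (i : Fin (n + 2)) :
    (t.face i).coords = t.coords.erase (t i) := by
  ext q
  rw [Finset.mem_erase, Tuple.mem_coords, Tuple.mem_coords]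
  constructor
  · rintro ⟨j, rfl⟩
    exact ⟨fun h => Fin.succAbove_ne i j (t.injective h), _, rfl⟩
  · rintro ⟨h, j, rfl⟩
    obtain ⟨l, rfl⟩ := Fin.exists_succAbove_eq (show j ≠ i from fun h' => h (h' ▸ rfl))
    exact ⟨l, rfl⟩

theorem Tuple.positionSign_coords {n : ℕ} (t : Tuple J n) (i : Fin (n + 1)) :
    positionSign (t i) t.coords = (-1) ^ (i : ℕ) := by
  have : t.coords.filter (· < t i) = (Finset.Iio i).map t.toEmbedding := by
    ext q
    simp only [Finset.mem_filter, Tuple.mem_coords, Finset.mem_map, Finset.mem_Iio]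
    constructor
    · rintro ⟨⟨j, rfl⟩, h⟩
      exact ⟨j, t.lt_iff_lt.1 h, rfl⟩
    · rintro ⟨j, h, rfl⟩
      exact ⟨⟨j, rfl⟩, t.lt_iff_lt.2 h⟩
  rw [positionSign, this, Finset.card_map, Fin.card_Iio]

/-- The simplicial chain of a chain of tuples. -/
def toChain (J : Type) [LinearOrder J] (n : ℕ) : (Tuple J n →₀ ℤ) →+ Chain J :=
  Finsupp.mapDomain.addMonoidHom Tuple.coords

/-- The chain of tuples of a simplicial chain. -/
def ofChain (J : Type) [LinearOrder J] (n : ℕ) : Chain J →+ (Tuple J n →₀ ℤ) :=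
  Finsupp.comapDomain.addMonoidHom (Tuple.coords_injective n)

variable {n : ℕ}

theorem toChain_single (t : Tuple J n) (c : ℤ) :
    toChain J n (Finsupp.single t c) = Finsupp.single t.coords c :=
  Finsupp.mapDomain_single

theorem toChain_apply (x : Tuple J n →₀ ℤ) (t : Tuple J n) : toChain J n x t.coords = x t :=
  Finsupp.mapDomain_apply (Tuple.coords_injective n) x t

theorem ofChain_apply (x : Chain J) (t : Tuple J n) : ofChain J n x t = x t.coords := rfl

theorem ofChain_toChain (x : Tuple J n →₀ ℤ) : ofChain J n (toChain J n x) = x :=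
  Finsupp.ext fun t => toChain_apply x t

theorem toChain_mem_univ (x : Tuple J n →₀ ℤ) : toChain J n x ∈ chains (n + 1) (Set.univ) := by
  induction x using Finsupp.induction_linear with
  | zero => rw [map_zero]; exact zero_mem _
  | add x y hx hy => rw [map_add]; exact add_mem hx hy
  | single t c => rw [toChain_single]; exact single_mem_chains t.card_coords (Set.subset_univ _) c

theorem chain_ext {S : Set J} {x y : Chain J} (hx : x ∈ chains (n + 1) S)
    (hy : y ∈ chains (n + 1) S) (h : ofChain J n x = ofChain J n y) : x = y := by
  rw [← sub_eq_zero]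
  have hxy := sub_mem hx hy
  ext s
  by_contra hs
  obtain ⟨t, rfl⟩ := Tuple.exists_coords_eq (mem_chains.1 hxy s hs).1
  refine hs ?_
  rw [Finsupp.sub_apply, ← ofChain_apply, ← ofChain_apply, h, sub_self]
  rfl

theorem toChain_ofChain {S : Set J} {x : Chain J} (hx : x ∈ chains (n + 1) S) :
    toChain J n (ofChain J n x) = x :=
  chain_ext (toChain_mem_univ _) (chains_mono (Set.subset_univ S) hx) (ofChain_toChain _)

theorem mem_PGroup_iff {a : J} {x : Tuple J n →₀ ℤ} :
    x ∈ PGroup J n a ↔ toChain J n x ∈ chains (n + 1) (Set.Ici a) := by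
  rw [mem_chains]
  constructor
  · intro h s hs
    obtain ⟨t, rfl⟩ := Tuple.exists_coords_eq (mem_chains.1 (toChain_mem_univ x) s hs).1
    rw [toChain_apply] at hs
    refine ⟨t.card_coords, fun q hq => ?_⟩
    obtain ⟨i, rfl⟩ := Tuple.mem_coords.1 (Finset.mem_coe.1 hq)
    exact h t hs i
  · intro h t ht i
    exact (h t.coords (by rwa [toChain_apply])).2 (Tuple.mem_coords.2 ⟨i, rfl⟩)

theorem ofChain_mem_PGroup {a : J} {x : Chain J} (hx : x ∈ chains (n + 1) (Set.Ici a)) :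
    ofChain J n x ∈ PGroup J n a := by
  rwa [mem_PGroup_iff, toChain_ofChain hx]

theorem boundary_single (t : Tuple J (n + 1)) : boundary J n (Finsupp.single t 1) =
    ∑ i : Fin (n + 2), (-1 : ℤ) ^ (i : ℕ) • Finsupp.single (t.face i) 1 := by
  simp [boundary]

theorem toChain_boundary (x : Tuple J (n + 1) →₀ ℤ) :
    toChain J n (boundary J n x) = bd (toChain J (n + 1) x) := by
  suffices (toChain J n).comp (boundary J n) = bd.toAddMonoidHom.comp (toChain J (n + 1)) from
    DFunLike.congr_fun this x
  refine Finsupp.addHom_ext' fun t => AddMonoidHom.ext_int ?_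
  change toChain J n (boundary J n (Finsupp.single t 1)) = bd (toChain J (n + 1) (Finsupp.single t 1))
  rw [boundary_single, toChain_single, bd_single, map_sum, Tuple.coords, Finset.sum_map]
  refine Finset.sum_congr rfl fun i _ => ?_
  rw [map_zsmul, toChain_single, Tuple.coords_face]
  change _ = link (t i) (Finsupp.single t.coords 1)
  rw [link_single_of_mem (Tuple.mem_coords.2 ⟨i, rfl⟩), Tuple.positionSign_coords]
  simp

theorem toChain_injective : Function.Injective (toChain J n) :=
  Finsupp.mapDomain_injective (Tuple.coords_injective n)

theorem boundary_boundary (x : Tuple J (n + 2) →₀ ℤ) :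
    boundary J n (boundary J (n + 1) x) = 0 := by
  apply toChain_injective
  rw [toChain_boundary, toChain_boundary, bd_bd, map_zero]

theorem boundary_eq_iff {x y : Tuple J (n + 1) →₀ ℤ} :
    boundary J n x = boundary J n y ↔ bd (toChain J (n + 1) x) = bd (toChain J (n + 1) y) := by
  rw [← toChain_boundary, ← toChain_boundary, toChain_injective.eq_iff]

theorem map_boundary_single {G : Type*} [AddCommGroup G] (L : (Tuple J n →₀ ℤ) →+ G)
    (t : Tuple J (n + 1)) : L (boundary J n (Finsupp.single t 1)) =
      ∑ i : Fin (n + 2), (-1 : ℤ) ^ (i : ℕ) • L (Finsupp.single (t.face i) 1) := by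
  simp only [boundary_single, map_sum, map_zsmul]

/-- The homomorphism given by a cochain. -/
def cochainHom {j m : ℕ} (c : Tuple J j → Tuple J m → ℤ) :
    (Tuple J j →₀ ℤ) →+ (Tuple J m → ℤ) :=
  Finsupp.liftAddHom fun t => zmultiplesHom _ (c t)

theorem cochainHom_single {j m : ℕ} (c : Tuple J j → Tuple J m → ℤ) (t : Tuple J j) :
    cochainHom c (Finsupp.single t 1) = c t := by
  simp [cochainHom]

theorem cochainHom_boundary_single {j m : ℕ} (c : Tuple J j → Tuple J m → ℤ)
    (t : Tuple J (j + 1)) :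
    cochainHom c (boundary J j (Finsupp.single t 1)) = coboundary c t := by
  rw [map_boundary_single]
  simp only [cochainHom_single, coboundary]

theorem cochainHom_boundary {j m : ℕ} (c : Tuple J j → Tuple J m → ℤ)
    (x : Tuple J (j + 1) →₀ ℤ) :
    cochainHom c (boundary J j x) = cochainHom (coboundary c) x := by
  suffices (cochainHom c).comp (boundary J j) = cochainHom (coboundary c) from
    DFunLike.congr_fun this x
  refine Finsupp.addHom_ext' fun t => AddMonoidHom.ext_int ?_
  change cochainHom c (boundary J j (Finsupp.single t 1)) =
    cochainHom (coboundary c) (Finsupp.single t 1)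
  rw [cochainHom_boundary_single, cochainHom_single]

theorem PGroup_le_of_single {a : J} {G : Type*} [AddCommGroup G] {L : (Tuple J n →₀ ℤ) →+ G}
    {N : AddSubgroup G} (h : ∀ t : Tuple J n, a ≤ t 0 → L (Finsupp.single t 1) ∈ N)
    {x : Tuple J n →₀ ℤ} (hx : x ∈ PGroup J n a) : L x ∈ N := by
  rw [← x.sum_single, Finsupp.sum, map_sum]
  refine sum_mem fun t ht => ?_
  rw [← mul_one (x t), ← smul_eq_mul, ← Finsupp.smul_single, map_zsmul]
  exact zsmul_mem (h t (hx t (Finsupp.mem_support_iff.1 ht) 0)) _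

theorem single_mem_PGroup {a : J} (t : Tuple J n) (ht : a ≤ t 0) :
    Finsupp.single t (1 : ℤ) ∈ PGroup J n a := fun t' ht' i => by
  obtain rfl : t = t' := by
    by_contra h
    exact ht' (Finsupp.single_eq_of_ne' h)
  exact ht.trans (t.monotone (Fin.zero_le i))

theorem cochainHom_mem {j m : ℕ} {c : Tuple J j → Tuple J m → ℤ} (hc : IsCochain c) {a : J}
    {x : Tuple J j →₀ ℤ} (hx : x ∈ PGroup J j a) : cochainHom c x ∈ RGroup J m a :=
  PGroup_le_of_single (fun t ht => by
    rw [cochainHom_single]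
    exact RGroup_le m ht (hc t)) hx

theorem coboundary_coboundary {j m : ℕ} (c : Tuple J j → Tuple J m → ℤ) :
    coboundary (coboundary c) = 0 := by
  funext t
  rw [← cochainHom_boundary_single, ← cochainHom_boundary, boundary_boundary, map_zero]
  rfl

theorem IsCochain.coboundary {j m : ℕ} {c : Tuple J j → Tuple J m → ℤ} (hc : IsCochain c) :
    IsCochain (coboundary c) := fun t =>
  sum_mem fun i _ => zsmul_mem (RGroup_le m (t.monotone (Fin.zero_le _)) (hc (t.face i))) _

end Tuples

/-! ### The cochain extending the section, its coherence and nontriviality -/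

section Boundaries

variable {J : Type} [LinearOrder J] {k : ℕ}

/-- There is no splitting of the boundary map into the `(k+1)`-element chains if the cofinality of
`J` is at least `ℵ_k`. -/
theorem not_exists_retraction (hJ : HasCofinalityGE k (Set.univ : Set J))
    (r : (Tuple J k →₀ ℤ) →+ (Tuple J (k + 1) →₀ ℤ))
    (hr : ∀ a, ∀ x ∈ PGroup J k a, r x ∈ PGroup J (k + 1) a)
    (h : ∀ x, boundary J k (r (boundary J k x)) = boundary J k x) : False := by
  -- The map id - d r preserves boundaries since d d = 0, and kills cycles since each of them is a
  -- boundary.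
  refine not_isSplitting hJ (LinearMap.id - ((toChain J k).comp ((boundary J k).comp
    (r.comp (ofChain J k)))).toIntLinearMap) ⟨?_, ?_, ?_⟩
  · intro a _ x hx
    rw [Set.univ_inter] at hx ⊢
    refine sub_mem hx ?_
    change toChain J k (boundary J k (r (ofChain J k x))) ∈ _
    rw [toChain_boundary]
    exact bd_mem (mem_PGroup_iff.1 (hr a _ (ofChain_mem_PGroup hx)))
  · intro x hx
    change bd (x - toChain J k (boundary J k (r (ofChain J k x)))) = bd x
    rw [map_sub, toChain_boundary, bd_bd, sub_zero]
  · intro x hx hx0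
    obtain ⟨y, hy, rfl⟩ := exists_bd_eq hx hx0
    change bd y - toChain J k (boundary J k (r (ofChain J k (bd y)))) = 0
    rw [← toChain_ofChain hy, ← toChain_boundary, ofChain_toChain, h, sub_self]

variable {B : Set (Tuple J (k + 1))} {f : Tuple J k → Tuple J (k + 1) → ℤ}

theorem cochainHom_boundary_of_support (hfB : ExtendsSection B f) {z : Tuple J (k + 1) →₀ ℤ}
    (hz : (z.support : Set (Tuple J (k + 1))) ⊆ B) : cochainHom f (boundary J k z) = z := by
  classical
  rw [cochainHom_boundary]
  funext t
  rw [cochainHom, Finsupp.liftAddHom_apply, Finsupp.sum, Finset.sum_apply,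
    Finset.sum_congr rfl (g := fun b => if t = b then z b else 0)]
  · rw [Finset.sum_ite_eq]
    split_ifs with h
    · rfl
    · rw [Finsupp.notMem_support_iff.1 h]
  · intro b hb
    rw [hfB b (hz hb)]
    change (z b • (Pi.single b (1 : ℤ) : Tuple J (k + 1) → ℤ)) t = _
    rw [Pi.smul_apply, Pi.single_apply]
    split_ifs <;> simp

theorem exists_cochainHom_boundary_eq (hB : IsBoundaryBasis k B) (hfB : ExtendsSection B f)
    {a : J} {x : Tuple J (k + 1) →₀ ℤ} (hx : x ∈ PGroup J (k + 1) a) :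
    ∃ z ∈ PGroup J (k + 1) a, boundary J k z = boundary J k x ∧
      cochainHom f (boundary J k x) = z := by
  obtain ⟨z, ⟨hz, hzB, hzx⟩, -⟩ := hB a x hx
  exact ⟨z, hz, hzx, by rw [← hzx, cochainHom_boundary_of_support hfB hzB]⟩

theorem isCoherent_of_extendsSection (hB : IsBoundaryBasis k B) (hfB : ExtendsSection B f) :
    IsCoherent f := fun t => by
  obtain ⟨z, -, -, hz⟩ := exists_cochainHom_boundary_eq hB hfB (single_mem_PGroup t le_rfl)
  rw [← cochainHom_boundary_single, hz]
  exact z.hasFiniteSupport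

/-- The difference f - c has finitely supported values and so defines a morphism r from P_k to
P_(k+1). On boundaries c contributes nothing and f returns a chain with the same boundary, so r is a
forbidden retraction. -/
theorem not_eqModFinite_of_coboundary_eq_zero {o : J} (ho : ∀ a, o ≤ a)
    (hJ : HasCofinalityGE k (Set.univ : Set J)) (hB : IsBoundaryBasis k B) (hf : IsCochain f)
    (hfB : ExtendsSection B f) {c : Tuple J k → Tuple J (k + 1) → ℤ} (hc : IsCochain c)
    (hc0 : coboundary c = 0) (hcf : ∀ t, EqModFinite (c t) (f t)) : False := by
  have hfin : ∀ t, (Function.support (f t - c t)).Finite := fun t =>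
    (hcf t).subset fun t' ht' h => ht' (by rw [Pi.sub_apply, h, sub_self])
  let r : (Tuple J k →₀ ℤ) →+ (Tuple J (k + 1) →₀ ℤ) :=
    Finsupp.liftAddHom fun t => zmultiplesHom _ (Finsupp.ofSupportFinite (f t - c t) (hfin t))
  have hr1 : ∀ t, r (Finsupp.single t 1) = Finsupp.ofSupportFinite (f t - c t) (hfin t) :=
    fun t => by simp [r]
  have hr : ∀ x, (r x : Tuple J (k + 1) → ℤ) = cochainHom f x - cochainHom c x := by
    intro x
    suffices Finsupp.coeFnAddHom.comp r = cochainHom f - cochainHom c from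
      DFunLike.congr_fun this x
    refine Finsupp.addHom_ext' fun t => AddMonoidHom.ext_int ?_
    change (r (Finsupp.single t 1) : Tuple J (k + 1) → ℤ) =
      cochainHom f (Finsupp.single t 1) - cochainHom c (Finsupp.single t 1)
    rw [hr1, cochainHom_single, cochainHom_single]
    rfl
  refine not_exists_retraction hJ r (fun a x hx => ?_) fun x => ?_
  · have := sub_mem (cochainHom_mem hf hx) (cochainHom_mem hc hx)
    rw [← hr] at this
    exact this
  · have hx : x ∈ PGroup J (k + 1) o := fun _ _ _ => ho _
    obtain ⟨z, -, hzx, hz⟩ := exists_cochainHom_boundary_eq hB hfB hx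
    have h0 : cochainHom c (boundary J k x) = 0 := by
      rw [cochainHom_boundary, hc0]
      refine DFunLike.congr_fun (f := cochainHom 0) (g := 0) ?_ x
      refine Finsupp.addHom_ext' fun t => AddMonoidHom.ext_int ?_
      exact cochainHom_single 0 t
    rw [← hzx]
    congr 1
    refine DFunLike.coe_injective ?_
    rw [hr, hzx, h0, hz, sub_zero]

theorem not_isTrivial_of_extendsSection {o : J} (ho : ∀ a, o ≤ a)
    (hJ : HasCofinalityGE k (Set.univ : Set J)) (hB : IsBoundaryBasis k B) (hf : IsCochain f)
    (hfB : ExtendsSection B f) : ¬ IsTrivial f := by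
  intro h
  cases k with
  | zero =>
    refine not_eqModFinite_of_coboundary_eq_zero ho hJ hB hf hfB (c := 0)
      (fun t => zero_mem _) ?_ h
    funext t
    simp [coboundary]
  | succ k =>
    obtain ⟨e, he, hef⟩ := h
    exact not_eqModFinite_of_coboundary_eq_zero ho hJ hB hf hfB he.coboundary
      (coboundary_coboundary e) hef

theorem exists_isBoundaryBasis (hJ : Cardinal.mk J < Cardinal.aleph (k + 1 : ℕ)) :
    ∃ B : Set (Tuple J (k + 1)), IsBoundaryBasis k B := by
  -- Tuples indexed by k + 1 have k + 2 coordinates, which matches the simplices of a chain basis of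
  -- index k + 1.
  obtain ⟨B, hB⟩ := exists_isChainBasis (k + 1) (A := (Set.univ : Set J))
    (by rwa [Cardinal.mk_univ])
  refine ⟨{t | t.coords ∈ B}, fun a x hx => ?_⟩
  obtain ⟨z, hz, hzB, hzx⟩ := hB.span a _ (by rw [Set.univ_inter]; exact mem_PGroup_iff.1 hx)
  rw [Set.univ_inter] at hz
  refine ⟨ofChain J (k + 1) z, ⟨ofChain_mem_PGroup hz, ?_, ?_⟩, ?_⟩
  · intro t ht
    have h := Finsupp.mem_support_iff.1 (Finset.mem_coe.1 ht)
    exact hzB (Finsupp.mem_support_iff.2 h)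
  · rw [boundary_eq_iff, toChain_ofChain hz, hzx]
  · rintro y ⟨-, hyB, hyx⟩
    have hyB' : toChain J (k + 1) y ∈ Finsupp.supported ℤ ℤ B := by
      intro s hs
      have hs' := Finsupp.mem_support_iff.1 hs
      obtain ⟨t, rfl⟩ := Tuple.exists_coords_eq (mem_chains.1 (toChain_mem_univ y) s hs').1
      rw [toChain_apply] at hs'
      exact hyB (Finsupp.mem_support_iff.2 hs')
    have h0 := hB.inj _ (sub_mem hyB' hzB) (by
      rw [map_sub, boundary_eq_iff.1 hyx, hzx, sub_self])
    rw [← sub_eq_zero.1 h0, ofChain_toChain]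

/-- Every boundary is the boundary of a unique chain supported on the basis `B`, and this chain
depends additively on the given one. -/
theorem exists_normalForm {o : J} (ho : ∀ a, o ≤ a) (hB : IsBoundaryBasis k B) :
    ∃ N : (Tuple J (k + 1) →₀ ℤ) →+ (Tuple J (k + 1) →₀ ℤ),
      (∀ x y, boundary J k x = boundary J k y → N x = N y) ∧
      (∀ b ∈ B, N (Finsupp.single b 1) = Finsupp.single b 1) ∧
      ∀ a, ∀ x ∈ PGroup J (k + 1) a, N x ∈ PGroup J (k + 1) a := by
  classical
  have hmem : ∀ x, x ∈ PGroup J (k + 1) o := fun _ _ _ _ => ho _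
  choose N hN hN' using fun x => hB o x (hmem x)
  have huniq : ∀ x z, (z.support : Set (Tuple J (k + 1))) ⊆ B →
      boundary J k z = boundary J k x → z = N x := fun x z h1 h2 => hN' x z ⟨hmem z, h1, h2⟩
  refine ⟨AddMonoidHom.mk' N fun x y => ?_, fun x y h => ?_, fun b hb => ?_, fun a x hx => ?_⟩
  · refine (huniq _ _ ?_ ?_).symm
    · refine (Finset.coe_subset.2 Finsupp.support_add).trans ?_
      rw [Finset.coe_union]
      exact Set.union_subset (hN x).2.1 (hN y).2.1
    · rw [map_add, map_add, (hN x).2.2, (hN y).2.2]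
  · exact huniq y (N x) (hN x).2.1 ((hN x).2.2.trans h)
  · refine (huniq _ _ ?_ rfl).symm
    intro t ht
    rw [Finset.mem_singleton.1 (Finsupp.support_single_subset ht)]
    exact hb
  · obtain ⟨z, ⟨hz, hzB, hzx⟩, -⟩ := hB a x hx
    change N x ∈ _
    rwa [← huniq x z hzB hzx]

/-- As R_(k+1) is a product, each coordinate b ∈ B is treated separately: the b-coordinate of the
normal form, a functional on boundaries, is to be extended to all of P_k so that it vanishes on
tails strictly above b 0. The successor γ (b 0) turns these into one closed tail. -/
theorem exists_extendsSection {o : J} (ho : ∀ a, o ≤ a)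
    (hsucc : ∀ b : J, ∃ g, ∀ q, g ≤ q ↔ b < q) (hB : IsBoundaryBasis k B) :
    ∃ f : Tuple J k → Tuple J (k + 1) → ℤ, IsCochain f ∧ ExtendsSection B f := by
  classical
  obtain ⟨N, hN, hNB, hNP⟩ := exists_normalForm ho hB
  choose γ hγ using hsucc
  -- The correction `w g` fixes cycles, so the functional keeps its values on boundaries. On a chain
  -- x in the tail at g it gives bd (cone g x), a boundary from that same tail.
  let w : J → Chain J →ₗ[ℤ] Chain J := fun g =>
    LinearMap.id - cone g ∘ₗ restr (Set.Ici g) ∘ₗ bd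
  have hw : ∀ g x, w g x = x - cone g (restr (Set.Ici g) (bd x)) := fun _ _ => rfl
  let L : Tuple J (k + 1) → (Tuple J k →₀ ℤ) →+ ℤ := fun b =>
    (Finsupp.applyAddHom b).comp (N.comp ((ofChain J (k + 1)).comp
      ((cone o ∘ₗ w (γ (b 0))).toAddMonoidHom.comp (toChain J k))))
  have hL : ∀ b x, L b x = N (ofChain J (k + 1) (cone o (w (γ (b 0)) (toChain J k x)))) b :=
    fun _ _ => rfl
  have hcone : ∀ g {x y : Chain J}, x ∈ chains (k + 1) (Set.univ : Set J) →
      y ∈ chains (k + 1 + 1) (Set.univ : Set J) → w g x = bd y →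
      N (ofChain J (k + 1) (cone o (w g x))) = N (ofChain J (k + 1) y) := by
    intro g x y hx hy h
    refine hN _ _ ?_
    have hb := bd_mem hy
    rw [boundary_eq_iff, toChain_ofChain hy,
      toChain_ofChain (cone_mem (Set.mem_univ o) (h ▸ hb)), h, bd_cone, bd_bd, map_zero, sub_zero]
  refine ⟨fun t b => if b ∈ B then L b (Finsupp.single t 1) else 0, ?_, ?_⟩
  · intro t b hb
    dsimp only at hb
    rw [ite_ne_right_iff] at hb
    suffices t 0 ≤ b 0 from fun i => this.trans (b.monotone (Fin.zero_le i))
    by_contra! hlt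
    have hg : γ (b 0) ≤ t 0 := (hγ _ _).2 hlt
    have hx : toChain J k (Finsupp.single t 1) ∈ chains (k + 1) (Set.Ici (γ (b 0))) :=
      mem_PGroup_iff.1 (single_mem_PGroup t hg)
    have hc := cone_mem (S := Set.Ici (γ (b 0))) (p := γ (b 0)) le_rfl hx
    refine hb.2 ?_
    rw [hL, hcone _ (toChain_mem_univ _) (chains_mono (Set.subset_univ _) hc)]
    -- The normal form of a chain in the tail at γ (b 0) stays in that tail, so it cannot involve b,
    -- whose least coordinate is too small.
    · by_contra hne
      exact lt_irrefl _ ((hγ _ _).1 (hNP _ _ (ofChain_mem_PGroup hc) b hne 0))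
    · rw [hw, restr_eq_self (bd_mem hx), bd_cone]
  · intro b hb
    funext b'
    have h1 : coboundary (fun (t : Tuple J k) (b : Tuple J (k + 1)) =>
        if b ∈ B then L b (Finsupp.single t 1) else 0) b b' =
        if b' ∈ B then L b' (boundary J k (Finsupp.single b 1)) else 0 := by
      rw [map_boundary_single, coboundary, Finset.sum_apply]
      split_ifs with h
      · exact Finset.sum_congr rfl fun i _ => by simp [h]
      · exact Finset.sum_eq_zero fun i _ => by simp [h]
    rw [h1]
    split_ifs with h
    · rw [hL, hcone _ (toChain_mem_univ _) (toChain_mem_univ (Finsupp.single b 1)),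
        ofChain_toChain, hNB b hb, Finsupp.single_apply, Pi.single_apply]
      · simp only [eq_comm]
      · rw [hw, toChain_boundary, bd_bd, LinearMap.map_zero, LinearMap.map_zero, sub_zero]
    · rw [Pi.single_apply, if_neg]
      rintro rfl
      exact h hb

end Boundaries

/-! ### Nonvanishing of the derived limits -/

section NonVanishing

variable {J : Type} [LinearOrder J] {k : ℕ} {B : Set (Tuple J (k + 1))}
  {f : Tuple J k → Tuple J (k + 1) → ℤ}

theorem antitone_RGroup (n : ℕ) : Antitone (RGroup J n) := fun _ _ h => RGroup_le n h

theorem toChain_mem_chainGroup {n : ℕ} {a : J} {x : Tuple J n →₀ ℤ} (hx : x ∈ PGroup J n a) :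
    toChain J n x ∈ chainGroup J (n + 1) a :=
  mem_PGroup_iff.1 hx

theorem ofChain_bd {n : ℕ} {S : Set J} {x : Chain J} (hx : x ∈ chains (n + 1 + 1) S) :
    ofChain J n (bd x) = boundary J n (ofChain J (n + 1) x) := by
  rw [← ofChain_toChain (boundary J n (ofChain J (n + 1) x)), toChain_boundary,
    toChain_ofChain hx]

theorem cochainHom_ofChain_mem (hf : IsCochain f) {a : J} {x : Chain J}
    (hx : x ∈ chainGroup J (k + 1) a) :
    cochainHom f (ofChain J k x) ∈ RGroup J (k + 1) a :=
  cochainHom_mem hf (ofChain_mem_PGroup hx)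

theorem exists_cochainHom_cycle_eq (hB : IsBoundaryBasis k B) (hfB : ExtendsSection B f) {a : J}
    {x : Chain J} (hx : x ∈ cycleGroup J (k + 1) a) :
    ∃ z ∈ PGroup J (k + 1) a, cochainHom f (ofChain J k x) = z := by
  have hc := cone_mem_chainGroup (cycleGroup_le hx)
  obtain ⟨z, hz, -, h⟩ := exists_cochainHom_boundary_eq hB hfB (ofChain_mem_PGroup hc)
  refine ⟨z, hz, ?_⟩
  rw [← h, ← ofChain_bd hc, bd_cone_of_mem hx]

/-- The morphism to `R_{k+1}` given by a cochain. -/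
def cochainMap (hf : IsCochain f) : CSys J (k + 1) ⟶ RSys J (k + 1) :=
  subSysMap (hN' := antitone_RGroup (k + 1)) ((cochainHom f).comp (ofChain J k))
    fun _ _ hx => cochainHom_ofChain_mem hf hx

/-- On cycles, f takes finitely supported values and so defines a morphism Z_(k+1) → P_(k+1). Were
the derived limit zero, this would extend to all chains, giving a retraction excluded by
`not_exists_retraction`. -/
theorem not_isZero_lim_PSys {o : J} (ho : ∀ a, o ≤ a)
    (hJ : HasCofinalityGE k (Set.univ : Set J)) (hB : IsBoundaryBasis k B) (hfB : ExtendsSection B f) :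
    ¬ IsZero ((limDer J (k + 1)).obj (PSys J (k + 1))) := by
  intro h
  choose z hz hzf using fun a (x : cycleGroup J (k + 1) a) =>
    exists_cochainHom_cycle_eq hB hfB x.2
  let φ : ZSys J (k + 1) ⟶ PSys J (k + 1) :=
    homMk (Y := PSys J (k + 1)) (fun a => (AddMonoidHom.mk'
      (fun x => (⟨z a x, hz a x⟩ : PGroup J (k + 1) a))
      fun x y => Subtype.ext (DFunLike.coe_injective (by
        change (z a (x + y) : Tuple J (k + 1) → ℤ) = z a x + z a y
        rw [← hzf, ← hzf, ← hzf, ← map_add, ← map_add]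
        rfl)) : cycleGroup J (k + 1) a →+ PGroup J (k + 1) a)) fun a b hab x hx => Subtype.ext (DFunLike.coe_injective (by
        change (z a ⟨x, _⟩ : Tuple J (k + 1) → ℤ) = z b ⟨x, hx⟩
        rw [← hzf, ← hzf]))
  obtain ⟨ψ, hψ⟩ := exists_extension_of_isZero h φ
  have hmem : ∀ x, x ∈ PGroup J k o := fun _ _ _ _ => ho _
  let v : ∀ a, chainGroup J (k + 1) a →+ PGroup J (k + 1) a := fun a => value ψ a
  have hv : ∀ a x (hx : x ∈ chainGroup J (k + 1) a),
      (v a ⟨x, hx⟩).1 = (v o ⟨x, antitone_chainGroup _ (ho a) hx⟩).1 := fun a x hx =>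
    congrArg (fun y : PGroup J (k + 1) o => y.1) (bond_value ψ (ho a) hx)
  let r : (Tuple J k →₀ ℤ) →+ (Tuple J (k + 1) →₀ ℤ) :=
    (PGroup J (k + 1) o).subtype.comp ((v o).comp
      ((toChain J k).codRestrict (chainGroup J (k + 1) o) fun x => toChain_mem_chainGroup (hmem x)))
  refine not_exists_retraction hJ r (fun a x hx => ?_) fun x => ?_
  · change (v o ⟨toChain J k x, _⟩).1 ∈ _
    rw [← hv a _ (toChain_mem_chainGroup hx)]
    exact (v a _).2
  · have hx : x ∈ PGroup J (k + 1) o := fun _ _ _ => ho _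
    obtain ⟨y, -, hyx, hy⟩ := exists_cochainHom_boundary_eq hB hfB hx
    have hcyc : toChain J k (boundary J k x) ∈ cycleGroup J (k + 1) o := by
      rw [toChain_boundary]
      exact bd_mem_cycleGroup (toChain_mem_chainGroup hx)
    have h1 : r (boundary J k x) = z o ⟨_, hcyc⟩ := by
      have := congrArg (fun g => (value g o ⟨_, hcyc⟩ : PGroup J (k + 1) o).1) hψ
      exact this
    rw [h1]
    refine (congrArg _ (DFunLike.coe_injective ?_)).trans hyx
    rw [← hzf, ← hy, ofChain_toChain]

theorem pointwiseExact_cokernel {X Y : Sys J} (g : X ⟶ Y) :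
    PointwiseExact g (cokernel.π g) :=
  pointwiseExact_of_exact (ShortComplex.mk g (cokernel.π g) (cokernel.condition g))
    (ShortComplex.exact_cokernel g)

theorem exists_component_cokernel_eq {X Y : Sys J} (g : X ⟶ Y) (a : J)
    (y : (cokernel g).obj (op a)) : ∃ x, component (cokernel.π g) a x = y :=
  (AddCommGrpCat.epi_iff_surjective ((cokernel.π g).app (op a))).1 inferInstance y

theorem toCycle_cycleIncl_comp {n : ℕ} (Y : Sys J) (E : CSys J n ⟶ Y) :
    cycleIncl J (n + 1) ≫ toCycle J n ≫ cycleIncl J n ≫ E = 0 := by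
  refine subSys_hom_ext fun a x => ?_
  change value E a ⟨bd x.1, _⟩ = 0
  have hx : bd x.1 = 0 := x.2.2
  simp only [hx]
  exact map_zero (value E a)

/-- Modulo P the cochain f kills cycles, so it factors through a morphism φ on Z_k. Vanishing of
lim^k would extend φ to C_k (or make it zero when k = 0), and lifting back to R would trivialize f
modulo finite. -/
theorem not_isZero_lim_RModP {o : J} (ho : ∀ a, o ≤ a)
    (hJ : HasCofinalityGE k (Set.univ : Set J)) (hB : IsBoundaryBasis k B) (hf : IsCochain f)
    (hfB : ExtendsSection B f) : ¬ IsZero ((limDer J k).obj (RModP J (k + 1))) := by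
  intro h
  let π : RSys J (k + 1) ⟶ RModP J (k + 1) := cokernel.π (PToR J (k + 1))
  have hπ0 : PToR J (k + 1) ≫ π = 0 := cokernel.condition _
  have hker : ∀ a (y : RGroup J (k + 1) a), component π a y = 0 →
      ∃ z ∈ PGroup J (k + 1) a, y.1 = z := fun a y hy => by
    obtain ⟨z, rfl⟩ := pointwiseExact_cokernel (PToR J (k + 1)) a y hy
    exact ⟨(show PGroup J (k + 1) a from z).1, (show PGroup J (k + 1) a from z).2, rfl⟩
  have hcyc : cycleIncl J (k + 1) ≫ cochainMap hf ≫ π = 0 := by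
    refine subSys_hom_ext fun a x => ?_
    obtain ⟨z, hz, hzx⟩ := exists_cochainHom_cycle_eq hB hfB x.2
    have h1 : value (cochainMap hf) a ⟨x.1, cycleGroup_le x.2⟩ =
        component (PToR J (k + 1)) a (⟨z, hz⟩ : PGroup J (k + 1) a) := Subtype.ext hzx
    exact (congrArg (component π a) h1).trans
      (congrArg (fun g => component g a (⟨z, hz⟩ : PGroup J (k + 1) a)) hπ0)
  obtain ⟨φ, hφ⟩ := exists_toCycle_comp_eq _ hcyc
  -- G plays the role of a coboundary agreeing with f modulo P. For k = 0 it is zero: C_0 is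
  -- constant rather than projective, so the lifting argument is available only for positive k.
  obtain ⟨G, hG0, hG⟩ : ∃ G : CSys J (k + 1) ⟶ RSys J (k + 1),
      cycleIncl J (k + 1) ≫ G = 0 ∧ G ≫ π = cochainMap hf ≫ π := by
    cases k with
    | zero =>
      refine ⟨0, comp_zero, ?_⟩
      rw [← hφ, eq_zero_of_isZero h φ, comp_zero, zero_comp]
    | succ j =>
      obtain ⟨ψ, hψ⟩ := exists_extension_of_isZero h φ
      obtain ⟨E, hE⟩ := exists_lift π ψ fun a x => exists_component_cokernel_eq _ a _
      refine ⟨toCycle J (j + 1) ≫ cycleIncl J (j + 1) ≫ E, toCycle_cycleIncl_comp _ E, ?_⟩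
      rw [Category.assoc, Category.assoc, hE, hψ, hφ]
  let v : ∀ a, chainGroup J (k + 1) a →+ RGroup J (k + 1) a := fun a => value G a
  have hv : ∀ a x (hx : x ∈ chainGroup J (k + 1) a),
      (v a ⟨x, hx⟩).1 = (v o ⟨x, antitone_chainGroup _ (ho a) hx⟩).1 := fun a x hx =>
    congrArg (fun y : RGroup J (k + 1) o => y.1) (bond_value G (ho a) hx)
  have hmem : ∀ x, x ∈ PGroup J k o := fun _ _ _ _ => ho _
  let r : (Tuple J k →₀ ℤ) →+ (Tuple J (k + 1) → ℤ) :=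
    (RGroup J (k + 1) o).subtype.comp ((v o).comp
      ((toChain J k).codRestrict (chainGroup J (k + 1) o) fun x => toChain_mem_chainGroup (hmem x)))
  have hr : ∀ a x (hx : x ∈ PGroup J k a), r x = (v a ⟨_, toChain_mem_chainGroup hx⟩).1 :=
    fun a x hx => (hv a _ _).symm
  have hsingle : ∀ t : Tuple J k, Finsupp.single t (1 : ℤ) ∈ PGroup J k (t 0) :=
    fun t => single_mem_PGroup t le_rfl
  refine not_eqModFinite_of_coboundary_eq_zero ho hJ hB hf hfB
    (c := fun t => r (Finsupp.single t 1)) (fun t => ?_) ?_ fun t => ?_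
  · dsimp only
    rw [hr _ _ (hsingle t)]
    exact (v _ _).2
  · funext t
    refine (map_boundary_single r t).symm.trans ?_
    have hx : toChain J k (boundary J k (Finsupp.single t 1)) ∈ cycleGroup J (k + 1) o := by
      rw [toChain_boundary]
      exact bd_mem_cycleGroup (toChain_mem_chainGroup fun _ _ _ => ho _)
    exact congrArg (fun g => (value g o ⟨_, hx⟩ : RGroup J (k + 1) o).1) hG0
  · have h1 : component π (t 0) (value (cochainMap hf - G) (t 0)
        ⟨_, toChain_mem_chainGroup (hsingle t)⟩) = 0 := by
      rw [← value_comp, Preadditive.sub_comp, hG, sub_self, value_zero]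
    obtain ⟨z, -, hz⟩ := hker _ _ h1
    have h2 : f t - r (Finsupp.single t 1) = z := by
      have h3 : f t = cochainHom f (ofChain J k (toChain J k (Finsupp.single t 1))) := by
        rw [ofChain_toChain, cochainHom_single]
      rw [h3, hr _ _ (hsingle t)]
      exact hz
    refine z.hasFiniteSupport.subset fun t' ht' => ?_
    rw [Function.mem_support, ← h2, Pi.sub_apply, sub_ne_zero]
    exact fun h => ht' h.symm

theorem le_cohomologicalDim {n : ℕ} {X : Sys J} (h : ¬ IsZero ((limDer J n).obj X)) :
    (n : ℕ∞) ≤ cohomologicalDim J :=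
  le_sSup ⟨n, rfl, X, h⟩

end NonVanishing

/-! ### Order properties of ω_k -/

section Omega

theorem exists_least_omegaType (k : ℕ) : ∃ o : OmegaType k, ∀ a, o ≤ a := by
  obtain ⟨b, -, -⟩ := hasCofinalityGE_omegaType k ∅ (Set.empty_subset _) (by
    rw [Cardinal.mk_eq_zero]; exact Cardinal.aleph_pos _)
  exact ⟨wellFounded_lt.min Set.univ ⟨b, trivial⟩, fun a => wellFounded_lt.min_le (Set.mem_univ a)⟩

theorem exists_succ_omegaType {k : ℕ} (b : OmegaType k) :
    ∃ g : OmegaType k, ∀ q, g ≤ q ↔ b < q := by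
  obtain ⟨c, -, hc⟩ := hasCofinalityGE_omegaType k {b} (Set.subset_univ _) (by
    rw [Cardinal.mk_singleton]
    exact Cardinal.one_lt_aleph0.trans_le (Cardinal.aleph0_le_aleph _))
  have hne : (Set.Ioi b).Nonempty := ⟨c, hc b rfl⟩
  exact ⟨wellFounded_lt.min _ hne, fun q =>
    ⟨fun h => lt_of_lt_of_le (wellFounded_lt.min_mem _ hne) h, fun h => wellFounded_lt.min_le h⟩⟩

theorem mk_omegaType_lt (k : ℕ) :
    Cardinal.mk (OmegaType k) < Cardinal.aleph (k + 1 : ℕ) := by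
  rw [Cardinal.mk_toType, Ordinal.card_omega, Cardinal.aleph_lt_aleph]
  exact_mod_cast Nat.lt_succ_self k

end Omega

end InverseSystem

end

theorem mainTheorem5 (k : ℕ) :
    ((k + 1 : ℕ) : ℕ∞) ≤ InverseSystem.cohomologicalDim (InverseSystem.OmegaType k) ∧
    ¬ IsZero ((InverseSystem.limDer (InverseSystem.OmegaType k) (k + 1)).obj
      (InverseSystem.PSys (InverseSystem.OmegaType k) (k + 1))) ∧
    ¬ IsZero ((InverseSystem.limDer (InverseSystem.OmegaType k) k).obj
      (InverseSystem.RModP (InverseSystem.OmegaType k) (k + 1))) ∧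
    (∃ (B : Set (InverseSystem.Tuple (InverseSystem.OmegaType k) (k + 1)))
        (f : InverseSystem.Tuple (InverseSystem.OmegaType k) k →
          InverseSystem.Tuple (InverseSystem.OmegaType k) (k + 1) → ℤ),
      InverseSystem.IsBoundaryBasis k B ∧ InverseSystem.IsCochain f ∧
        InverseSystem.ExtendsSection B f) ∧
    (∀ (B : Set (InverseSystem.Tuple (InverseSystem.OmegaType k) (k + 1)))
        (f : InverseSystem.Tuple (InverseSystem.OmegaType k) k →
          InverseSystem.Tuple (InverseSystem.OmegaType k) (k + 1) → ℤ),
      InverseSystem.IsBoundaryBasis k B → InverseSystem.IsCochain f →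
        InverseSystem.ExtendsSection B f →
          InverseSystem.IsCoherent f ∧ ¬ InverseSystem.IsTrivial f) := by
  obtain ⟨o, ho⟩ := InverseSystem.exists_least_omegaType k
  have hJ := InverseSystem.hasCofinalityGE_omegaType k
  obtain ⟨B, hB⟩ := InverseSystem.exists_isBoundaryBasis (InverseSystem.mk_omegaType_lt k)
  obtain ⟨f, hf, hfB⟩ := InverseSystem.exists_extendsSection ho
    InverseSystem.exists_succ_omegaType hB
  have hP := InverseSystem.not_isZero_lim_PSys ho hJ hB hfB
  exact ⟨InverseSystem.le_cohomologicalDim hP, hP,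
    InverseSystem.not_isZero_lim_RModP ho hJ hB hf hfB, ⟨B, f, hB, hf, hfB⟩,
    fun _ _ hB hf hfB => ⟨InverseSystem.isCoherent_of_extendsSection hB hfB,
      InverseSystem.not_isTrivial_of_extendsSection ho hJ hB hf hfB⟩⟩
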